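/- Let $\sigma,\tilde\sigma,\lambda>0$, let $M$ be a positive integer and let $w\in\mathbb{R}^4$. For $s=1,2,\dots$ let $u_s$ be uniformly distributed on the northern hemisphere $\{u\in\mathbb{R}^3:\|u\|=1,\ u_3\ge 0\}$, let $z_s,\tilde z_s$ be standard Gaussian, let $m_s$ be uniformly distributed on $\{-M,\dots,M\}$, and let all these random variables be independent. For every number $S$ of satellites let $G$ be the $S\times4$ matrix with rows $g_s^{\mathsf T}=(-u_s^{\mathsf T},1)$, $1\le s\le S$, and let $$y=Gw+\sigma z,\qquad \tilde y=Gw+\lambda m+\tilde\sigma\tilde z$$ be the observed vectors of pseudo-range and carrier-phase measurements, where $z=(z_s)_{s\le S}$, $\tilde z=(\tilde z_s)_{s\le S}$, $m=(m_s)_{s\le S}$. For $v\in\mathbb{R}^4$ let $\mathbb{E}_v(m\mid\tilde y,G)\in\mathbb{R}^S$ be the conditional expectation of $m$ under the hypothesis that the true parameter is $v$, that is, the vector with entries $$\mathbb{E}_v(m_s\mid\tilde y,G)=\frac{\sum_{k=-M}^{M}k\,\exp\bigl(-\tfrac{1}{2\tilde\sigma^2}(\tilde y_s-g_s^{\mathsf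 T}v-\lambda k)^2\bigr)}{\sum_{k=-M}^{M}\exp\bigl(-\tfrac{1}{2\tilde\sigma^2}(\tilde y_s-g_s^{\mathsf T}v-\lambda k)^2\bigr)} .$$ Let the estimator $\hat w=\hat w_S$ be, whenever $G^{\mathsf T}G$ is invertible, a solution $v=\hat w$ of the likelihood equation $$v=(G^{\mathsf T}G)^{-1}G^{\mathsf T}\Bigl(\frac{\sigma^{-2}}{\sigma^{-2}+\tilde\sigma^{-2}}\,y+\frac{\tilde\sigma^{-2}}{\sigma^{-2}+\tilde\sigma^{-2}}\bigl(\tilde y-\lambda\,\mathbb{E}_v(m\mid\tilde y,G)\bigr)\Bigr)$$ that is closest in Euclidean norm, among all solutions, to the pseudo-range only estimator $(G^{\mathsf T}G)^{-1}G^{\mathsf T}y$. Then $\hat w_S$ is consistent, i.e. $\hat w_S\to w$ in probability as $S\to\infty$, and $\sqrt S\,(\hat w_S-w)$ converges in distribution, as $S\to\infty$, to a Gaussian vector with mean zero and covariance matrix $$\frac{1}{\sigma^{-2}+h_M(\lambda/\tilde\sigma)\,\tilde\sigma^{-2}}\,Q,\qquad Q=\begin{pmatrix}3&0&0&0\\0&3&0&0\\0&0&12&6\\0&0&6&4\end{pmatrix},$$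 where, for $a\ge 0$, $$h_M(a)=1-a^2\,\mathbb{E}\bigl(H_2(a,m_1,\tilde z_1)-H_1(a,m_1,\tilde z_1)^2\bigr),\qquad H_k(a,n,z)=\frac{\sum_{j=-M}^{M}j^k\exp\bigl(-\tfrac12(a(j-n)-z)^2\bigr)}{\sum_{j=-M}^{M}\exp\bigl(-\tfrac12(a(j-n)-z)^2\bigr)} .$$ -/

import Mathlib

open MeasureTheory ProbabilityTheory Filter Topology Matrix

noncomputable section

namespace GNSS

/-- Three-dimensional Euclidean space, in which the satellite directions live; the coordinate with
index `2` is the vertical (north) one. -/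
abbrev E3 : Type := EuclideanSpace ℝ (Fin 3)

/-- The parameter space `ℝ⁴`: a parameter vector is `w = (x, b)` with `x ∈ ℝ³` the receiver position
and `b ∈ ℝ` the clock bias. -/
abbrev E4 : Type := EuclideanSpace ℝ (Fin 4)

/-- The unit sphere of `ℝ³`. -/
abbrev Sph : Type := Metric.sphere (0 : E3) 1

/-- The uniform distribution on the northern hemisphere: the surface measure of the unit sphere,
conditioned on the set of unit vectors with nonnegative vertical coordinate. -/
def hemisphereUniform : Measure Sph :=
  ProbabilityTheory.cond (volume : Measure E3).toSphere {u : Sph | 0 ≤ (u : E3) 2}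

/-- The uniform distribution on the integers `{-M, …, M}`, the prior of an ambiguity. -/
def ambiguityPrior (M : ℕ) : Measure ℤ :=
  uniformOn (Set.Icc (-(M : ℤ)) (M : ℤ))

/-- The joint law of `(u, z, z̃, m)` for one satellite: independent components, `u` uniform on the
hemisphere, `z` and `z̃` standard Gaussian, `m` uniform on `{-M, …, M}`. -/
def satelliteLaw (M : ℕ) : Measure (Sph × ℝ × ℝ × ℤ) :=
  hemisphereUniform.prod ((gaussianReal 0 1).prod ((gaussianReal 0 1).prod (ambiguityPrior M)))

/-- The row `gᵀ = (-uᵀ, 1)` of the design matrix for the direction `u`. -/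
def designRow (u : Sph) : Fin 4 → ℝ :=
  ![-(u : E3) 0, -(u : E3) 1, -(u : E3) 2, 1]

/-- The `S × 4` design matrix `G` with rows `(-u_sᵀ, 1)`. -/
def designMatrix {S : ℕ} (u : Fin S → Sph) : Matrix (Fin S) (Fin 4) ℝ :=
  Matrix.of fun s => designRow (u s)

/-- The pseudo-range measurements `y = G w + σ z`. -/
def pseudoRange {S : ℕ} (σ : ℝ) (w : E4) (u : Fin S → Sph) (z : Fin S → ℝ) : Fin S → ℝ :=
  designMatrix u *ᵥ w.ofLp + σ • z

/-- The carrier-phase measurements `ỹ = G w + λ m + σ̃ z̃`. -/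
def carrierPhase {S : ℕ} (lam σt : ℝ) (w : E4) (u : Fin S → Sph) (m : Fin S → ℤ)
    (zt : Fin S → ℝ) : Fin S → ℝ :=
  designMatrix u *ᵥ w.ofLp + lam • (fun s => (m s : ℝ)) + σt • zt

/-- The least-squares map `v ↦ (Gᵀ G)⁻¹ Gᵀ v`. -/
def leastSquares {S : ℕ} (G : Matrix (Fin S) (Fin 4) ℝ) (v : Fin S → ℝ) : E4 :=
  WithLp.toLp 2 ((Gᵀ * G)⁻¹ *ᵥ (Gᵀ *ᵥ v))

/-- The conditional expectations `𝔼_v(m_s ∣ ỹ, G)`, `s = 1, …, S`, of the ambiguities under the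
hypothesis that the true parameter vector is `v`, in the closed form given by Bayes' rule:
`∑ₘ m exp(-(ỹ_s - g_sᵀ v - λ m)² / (2 σ̃²)) / ∑ₘ exp(-(ỹ_s - g_sᵀ v - λ m)² / (2 σ̃²))`, with both
sums over `m ∈ {-M, …, M}`. -/
def ambiguityMMSE (M : ℕ) (lam σt : ℝ) {S : ℕ} (G : Matrix (Fin S) (Fin 4) ℝ) (yt : Fin S → ℝ)
    (v : E4) : Fin S → ℝ := fun s =>
  (∑ m ∈ Finset.Icc (-(M : ℤ)) (M : ℤ),
      (m : ℝ) * Real.exp (-(1 / (2 * σt ^ 2)) * (yt s - (G *ᵥ v.ofLp) s - lam * (m : ℝ)) ^ 2)) /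
    (∑ m ∈ Finset.Icc (-(M : ℤ)) (M : ℤ),
      Real.exp (-(1 / (2 * σt ^ 2)) * (yt s - (G *ᵥ v.ofLp) s - lam * (m : ℝ)) ^ 2))

/-- `v` solves the likelihood equation
`v = (Gᵀ G)⁻¹ Gᵀ (σ⁻²/(σ⁻² + σ̃⁻²) y + σ̃⁻²/(σ⁻² + σ̃⁻²) (ỹ - λ 𝔼_v(m ∣ ỹ, G)))`. -/
def IsLikelihoodRoot (M : ℕ) (lam σ σt : ℝ) {S : ℕ} (G : Matrix (Fin S) (Fin 4) ℝ)
    (y yt : Fin S → ℝ) (v : E4) : Prop :=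
  v = leastSquares G
    ((σ⁻¹ ^ 2 / (σ⁻¹ ^ 2 + σt⁻¹ ^ 2)) • y +
      (σt⁻¹ ^ 2 / (σ⁻¹ ^ 2 + σt⁻¹ ^ 2)) • (yt - lam • ambiguityMMSE M lam σt G yt v))

/-- `v` is a solution of the likelihood equation that is closest, in Euclidean norm, to the
pseudo-range only estimator `(Gᵀ G)⁻¹ Gᵀ y`. -/
def IsClosestLikelihoodRoot (M : ℕ) (lam σ σt : ℝ) {S : ℕ} (G : Matrix (Fin S) (Fin 4) ℝ)
    (y yt : Fin S → ℝ) (v : E4) : Prop :=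
  IsLikelihoodRoot M lam σ σt G y yt v ∧
    ∀ v' : E4, IsLikelihoodRoot M lam σ σt G y yt v' →
      ‖v - leastSquares G y‖ ≤ ‖v' - leastSquares G y‖

/-- The posterior moment `H_k(a, n, z)` of the ambiguity:
`∑ₘ mᵏ exp(-(a (m - n) - z)² / 2) / ∑ₘ exp(-(a (m - n) - z)² / 2)`, `m ∈ {-M, …, M}`. -/
def posteriorMoment (M k : ℕ) (a : ℝ) (n : ℤ) (z : ℝ) : ℝ :=
  (∑ m ∈ Finset.Icc (-(M : ℤ)) (M : ℤ),
      (m : ℝ) ^ k * Real.exp (-(1 / 2) * (a * ((m : ℝ) - (n : ℝ)) - z) ^ 2)) /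
    (∑ m ∈ Finset.Icc (-(M : ℤ)) (M : ℤ),
      Real.exp (-(1 / 2) * (a * ((m : ℝ) - (n : ℝ)) - z) ^ 2))

/-- `h_M(a) = 1 - a² 𝔼(H₂(a, m, z̃) - H₁(a, m, z̃)²)`, with `m` uniform on `{-M, …, M}` and `z̃` an
independent standard Gaussian. -/
def hFactor (M : ℕ) (a : ℝ) : ℝ :=
  1 - a ^ 2 * ∫ p : ℤ × ℝ, (posteriorMoment M 2 a p.1 p.2 - posteriorMoment M 1 a p.1 p.2 ^ 2)
    ∂((ambiguityPrior M).prod (gaussianReal 0 1))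

/-- The matrix `Q`. -/
def Qmat : Matrix (Fin 4) (Fin 4) ℝ :=
  !![3, 0, 0, 0;
     0, 3, 0, 0;
     0, 0, 12, 6;
     0, 0, 6, 4]

end GNSS

end

/-! Write `v = w + d`. When `Gᵀ G` is invertible, multiplying the likelihood equation by it gives a
sum of i.i.d. terms, `∑ score (x_s) d = 0`. The estimator is therefore a Z-estimator, and the
classical sandwich argument applies once the two covariance ingredients are computed and the choice
of the root is controlled.

The covariance rests on an information identity. The function `corrected`, `x ↦ x - λ 𝔼(m ∣ x)`, is
`-σ̃²` times the logarithmic derivative of the density of `λ m + σ̃ z̃`, a Gaussian mixture.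
Integration by parts against this density (`integral_mul_corrected`) shows that `corrected` has mean
zero and that its second moment is `σ̃²` times its mean slope. The slope is one minus `(λ/σ̃)²`
times the posterior variance of `m`, so its mean is `h = h_M(λ/σ̃)`. Put `D = σ⁻² + σ̃⁻²` and `J =
σ⁻² + h σ̃⁻²`. The score at `d = 0` has covariance `(J/D²) Q⁻¹`, and minus its mean derivative is
`(J/D) Q⁻¹`; the sandwich is `J⁻¹ Q`. Here `Q⁻¹ = 𝔼(g gᵀ)` comes from the moments of the hemisphere.

The choice of the root is handled by `closest_zero_limit`. The averaged normalized score is, near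
`0`, a small Lipschitz perturbation of minus the identity plus a constant, so it has a zero of norm
at most twice the norm of its value at `0`, which tends to `0` by the law of large numbers. The
pilot estimator is consistent as well (`pilot_consistent`), and the root closest to it is at least
as close as this zero. Hence it converges almost surely to `w`, whatever other roots exist.
Linearizing the score at that root and applying the central limit theorem gives the limit law. -/

noncomputable section

namespace GNSS

/-! ### Convergence in distribution: Slutsky and the multivariate central limit theorem -/

section LimitTheorems

variable {Ω : Type*} [MeasurableSpace Ω] {P : Measure Ω} [IsProbabilityMeasure P]
  {E : Type*} [NormedAddCommGroup E] [InnerProductSpace ℝ E] [FiniteDimensional ℝ E]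
  [MeasurableSpace E] [BorelSpace E]

omit [InnerProductSpace ℝ E] [FiniteDimensional ℝ E] in
-- Portmanteau theorem for the closed sets `{ε ≤ ‖x‖}`, which the point mass at `0` does not charge.
theorem tendstoInMeasure_zero_of_tendstoInDistribution {X : ℕ → Ω → E}
    (hX : TendstoInDistribution X atTop (fun _ : Ω => (0 : E)) (fun _ => P) P) :
    TendstoInMeasure P X atTop 0 := by
  rw [tendstoInMeasure_iff_norm]
  intro ε hε
  have hF : IsClosed {x : E | ε ≤ ‖x‖} := isClosed_le continuous_const continuous_norm
  have h := ProbabilityMeasure.limsup_measure_closed_le_of_tendsto hX.tendsto hF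
  have h0 : (P.map (fun _ : Ω => (0 : E))) {x : E | ε ≤ ‖x‖} = 0 := by
    rw [Measure.map_apply measurable_const hF.measurableSet]
    have : (fun _ : Ω => (0 : E)) ⁻¹' {x : E | ε ≤ ‖x‖} = ∅ := by
      ext; simp [hε]
    simp [this]
  simp only [ProbabilityMeasure.coe_mk] at h
  rw [h0] at h
  have h1 := tendsto_of_le_liminf_of_limsup_le (bot_le) h
  refine h1.congr fun n => ?_
  rw [Measure.map_apply_of_aemeasurable (hX.forall_aemeasurable n) hF.measurableSet]
  simp

/-- The product of a null sequence and a sequence that converges in distribution is null in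
probability. -/
theorem tendstoInMeasure_smul_zero {Ω' : Type*} [MeasurableSpace Ω'] {P' : Measure Ω'}
    [IsProbabilityMeasure P'] {X : ℕ → Ω → E} {Z : Ω' → E} {η : ℕ → Ω → ℝ}
    (hX : TendstoInDistribution X atTop Z (fun _ => P) P')
    (hη : ∀ n, AEMeasurable (η n) P)
    (hη0 : ∀ᵐ ω ∂P, Tendsto (fun n => η n ω) atTop (𝓝 0)) :
    TendstoInMeasure P (fun n ω => η n ω • X n ω) atTop 0 := by
  have h1 : TendstoInMeasure P η atTop (fun _ => (0 : ℝ)) :=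
    tendstoInMeasure_of_tendsto_ae (fun n => (hη n).aestronglyMeasurable) hη0
  -- Slutsky: the products converge in distribution to `0 • Z`, whose law is the point mass at `0`.
  have h2 := hX.continuous_comp_prodMk_of_tendstoInMeasure_const
    (g := fun x : E × ℝ => x.2 • x.1) (by fun_prop) h1 hη
  apply tendstoInMeasure_zero_of_tendstoInDistribution
  refine ⟨h2.forall_aemeasurable, by fun_prop, ?_⟩
  convert h2.tendsto using 2
  ext1
  simp

/-- The multivariate central limit theorem for centred square-integrable vectors. -/
theorem tendstoInDistribution_inv_sqrt_smul_sum {V : ℕ → Ω → E} {ν : Measure E}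
    [IsProbabilityMeasure ν] {q : E → ℝ}
    (hν : ∀ t, charFun ν t = Complex.exp (-(q t : ℂ) / 2))
    (hL2 : MemLp (V 0) 2 P) (hmean : P[V 0] = 0)
    (hq : ∀ t, ∫ ω, (inner ℝ t (V 0 ω)) ^ 2 ∂P = q t)
    (hindep : iIndepFun V P) (hident : ∀ i, IdentDistrib (V i) (V 0) P P) :
    TendstoInDistribution (fun (n : ℕ) ω => (√(n : ℝ))⁻¹ • ∑ k ∈ Finset.range n, V k ω) atTop
      (id : E → E) (fun _ => P) ν where
  forall_aemeasurable n :=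
    (Finset.aemeasurable_fun_sum _ fun k _ => (hident k).aemeasurable_fst).const_smul _
  aemeasurable_limit := aemeasurable_id
  tendsto := by
    refine ProbabilityMeasure.tendsto_iff_tendsto_charFun.2 fun t => ?_
    let Xt : ℕ → Ω → ℝ := fun n ω => inner ℝ t (V n ω)
    have hlin : Measurable fun x : E => inner ℝ t x := by fun_prop
    have hXL2 : MemLp (Xt 0) 2 P := hL2.const_inner t
    have hXmean : P[Xt 0] = 0 := by
      have := integral_inner (𝕜 := ℝ) (hL2.integrable one_le_two) t
      simp only [Xt, this]
      simp [hmean]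
    have hvar : Var[Xt 0; P] = q t := by
      rw [variance_of_integral_eq_zero hXL2.aestronglyMeasurable.aemeasurable hXmean]
      exact hq t
    have hqt : 0 ≤ q t := hvar ▸ variance_nonneg _ _
    have hY : HasLaw (id : ℝ → ℝ) (gaussianReal 0 Var[Xt 0; P].toNNReal)
      (gaussianReal 0 Var[Xt 0; P].toNNReal) := HasLaw.id
    have hclt := tendstoInDistribution_inv_sqrt_mul_sum_sub hY hXL2
      (hindep.comp (fun _ x => inner ℝ t x) fun _ => hlin) (fun i => (hident i).comp hlin)
    -- Cramér–Wold: the characteristic function of the vector sum at `t` is that of the scalar sum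
    -- of `⟪t, V k⟫` at `1`.
    have h1 := ProbabilityMeasure.tendsto_iff_tendsto_charFun.1 hclt.tendsto 1
    simp only [ProbabilityMeasure.coe_mk, Measure.map_id, hXmean, mul_zero, sub_zero] at h1 ⊢
    rw [hν]
    convert h1 using 1
    · ext n
      rw [charFun_apply, charFun_apply, integral_map, integral_map]
      · congr 1
        ext ω
        congr 2
        simp only [Xt, real_inner_smul_left, sum_inner]
        simp [real_inner_comm]
      · exact (Finset.aemeasurable_fun_sum _ fun k _ =>
          hlin.comp_aemeasurable (hident k).aemeasurable_fst).const_mul _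
      · fun_prop
      · exact (Finset.aemeasurable_fun_sum _ fun k _ => (hident k).aemeasurable_fst).const_smul _
      · fun_prop
    · rw [charFun_gaussianReal, hvar]
      simp [hqt, neg_div]

end LimitTheorems

/-! ### Zeros of perturbations of the identity -/

/-- A map that is close to the identity on a ball around `0` has a zero there. -/
theorem exists_zero_of_approx_id {E : Type*} [NormedAddCommGroup E] [NormedSpace ℝ E]
    [CompleteSpace E] {H : E → E}
    (hH : ∀ x ∈ Metric.closedBall (0 : E) (2 * ‖H 0‖), ∀ y ∈ Metric.closedBall (0 : E) (2 * ‖H 0‖),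
      ‖H x - H y - (x - y)‖ ≤ 1 / 2 * ‖x - y‖) :
    ∃ d : E, ‖d‖ ≤ 2 * ‖H 0‖ ∧ H d = 0 := by
  let R : (ContinuousLinearMap.id ℝ E).NonlinearRightInverse :=
    { toFun := id, nnnorm := 1, bound' := fun y => by simp, right_inv' := fun y => by simp }
  have happ : ApproximatesLinearOn H (ContinuousLinearMap.id ℝ E)
      (Metric.closedBall (0 : E) (2 * ‖H 0‖)) (1 / 2) := by
    intro x hx y hy
    simpa using hH x hx y hy
  have hs := happ.surjOn_closedBall_of_nonlinearRightInverse R (ε := 2 * ‖H 0‖) (b := 0)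
    (by positivity) subset_rfl
  -- The image of the ball of radius `2‖H 0‖` contains the ball around `H 0` of radius `(1 - 1/2) ·
  -- 2‖H 0‖ = ‖H 0‖`, which just reaches `0`.
  have h0 : (0 : E) ∈ Metric.closedBall (H 0) (((R.nnnorm : ℝ)⁻¹ - ((1 / 2 : NNReal) : ℝ)) *
      (2 * ‖H 0‖)) := by
    simp only [R, Metric.mem_closedBall, dist_zero_left]
    norm_num
    linarith
  obtain ⟨d, hd, hd0⟩ := hs h0
  exact ⟨d, by simpa using hd, hd0⟩

/-- The error has two sources: the individual linearization errors, which average, and the deviation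
of the averaged `A i` from the identity. -/
theorem norm_average_add_le {E ι : Type*} [NormedAddCommGroup E] [NormedSpace ℝ E]
    {Ψ : ι → E → E} {A : ι → E →L[ℝ] E} {K : ℝ} {d d' : E}
    (happrox : ∀ i, ‖Ψ i d - Ψ i d' + A i (d - d')‖ ≤ K * max ‖d‖ ‖d'‖ * ‖d - d'‖)
    (s : Finset ι) (hs : s.Nonempty) :
    ‖(s.card : ℝ)⁻¹ • ∑ i ∈ s, Ψ i d - (s.card : ℝ)⁻¹ • ∑ i ∈ s, Ψ i d' + (d - d')‖ ≤
      (‖(s.card : ℝ)⁻¹ • ∑ i ∈ s, A i - ContinuousLinearMap.id ℝ E‖ + K * max ‖d‖ ‖d'‖) *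
        ‖d - d'‖ := by
  have hc : (0 : ℝ) < s.card := by exact_mod_cast hs.card_pos
  set B := (s.card : ℝ)⁻¹ • ∑ i ∈ s, A i
  have h1 : (s.card : ℝ)⁻¹ • ∑ i ∈ s, Ψ i d - (s.card : ℝ)⁻¹ • ∑ i ∈ s, Ψ i d' + (d - d') =
      (s.card : ℝ)⁻¹ • ∑ i ∈ s, (Ψ i d - Ψ i d' + A i (d - d')) -
        (B - ContinuousLinearMap.id ℝ E) (d - d') := by
    simp only [B, Finset.sum_add_distrib, Finset.sum_sub_distrib, smul_add, smul_sub,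
      _root_.sub_apply, _root_.smul_apply,
      ContinuousLinearMap.id_apply, _root_.sum_apply]
    abel
  rw [h1]
  refine (norm_sub_le _ _).trans ?_
  rw [add_mul, add_comm]
  gcongr
  · exact ContinuousLinearMap.le_opNorm _ _
  · rw [norm_smul, norm_inv, Real.norm_of_nonneg hc.le, inv_mul_le_iff₀ hc]
    refine (norm_sum_le_of_le _ fun i _ => happrox i).trans ?_
    simp

/-! ### Asymptotics of the closest zero of an empirical score -/

section Estimation

variable {Ω 𝓧 : Type*} [MeasurableSpace Ω] [MeasurableSpace 𝓧] {P : Measure Ω}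
  [IsProbabilityMeasure P] {μ : Measure 𝓧}
  {E : Type*} [NormedAddCommGroup E] [InnerProductSpace ℝ E] [FiniteDimensional ℝ E]
  [MeasurableSpace E] [BorelSpace E]

omit [IsProbabilityMeasure P] in
/-- The strong law of large numbers for a function of an i.i.d. sequence. -/
theorem strong_law_of_hasLaw {F : Type*} [NormedAddCommGroup F] [NormedSpace ℝ F]
    [CompleteSpace F] [MeasurableSpace F] [BorelSpace F] {ξ : ℕ → Ω → 𝓧}
    (hlaw : ∀ s, HasLaw (ξ s) μ P) (hindep : iIndepFun ξ P) {f : 𝓧 → F} (hf : Measurable f)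
    (hint : Integrable f μ) :
    ∀ᵐ ω ∂P, Tendsto (fun n : ℕ => (n : ℝ)⁻¹ • ∑ i ∈ Finset.range n, f (ξ i ω)) atTop
      (𝓝 (∫ x, f x ∂μ)) := by
  have hmap := (hlaw 0).map_eq
  have hfs : AEStronglyMeasurable f (P.map (ξ 0)) := by rw [hmap]; exact hint.1
  have h := strong_law_ae (μ := P) (fun s ω => f (ξ s ω))
    (by
      have : Integrable (f ∘ ξ 0) P :=
        (integrable_map_measure hfs (hlaw 0).aemeasurable).1 (by rwa [hmap])
      exact this)
    (fun i j hij => (hindep.indepFun hij).comp hf hf)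
    (fun i => ((hlaw i).identDistrib (hlaw 0)).comp hf)
  have h2 : ∫ x, f x ∂μ = ∫ ω, f (ξ 0 ω) ∂P := by
    rw [← hmap, integral_map (hlaw 0).aemeasurable hfs]
  rw [h2]
  exact h

/-- Consistency and asymptotic normality of the zero of an empirical score that is closest to a
consistent pilot estimator. The true parameter is `0` and the score is normalized so that its
expected derivative at `0` is minus the identity. -/
theorem closest_zero_limit {ξ : ℕ → Ω → 𝓧} (hlaw : ∀ s, HasLaw (ξ s) μ P)
    (hindep : iIndepFun ξ P) {Ψ : 𝓧 → E → E} {A : 𝓧 → E →L[ℝ] E} {K : ℝ} (hK : 0 ≤ K)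
    (hA : Measurable A) (hAint : Integrable A μ)
    (hAmean : ∫ x, A x ∂μ = ContinuousLinearMap.id ℝ E)
    (hΨ : Measurable fun x => Ψ x 0) (hΨ2 : MemLp (fun x => Ψ x 0) 2 μ)
    (hΨmean : ∫ x, Ψ x 0 ∂μ = 0) {q : E → ℝ}
    (hq : ∀ t, ∫ x, (inner ℝ t (Ψ x 0)) ^ 2 ∂μ = q t)
    (happrox : ∀ x d d', ‖Ψ x d - Ψ x d' + A x (d - d')‖ ≤ K * max ‖d‖ ‖d'‖ * ‖d - d'‖)
    {ν : Measure E} [IsProbabilityMeasure ν]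
    (hν : ∀ t, charFun ν t = Complex.exp (-(q t : ℂ) / 2))
    {dhat c : ℕ → Ω → E} (hdhat : ∀ n, AEMeasurable (dhat n) P)
    (hc : ∀ᵐ ω ∂P, Tendsto (fun n => c n ω) atTop (𝓝 0))
    (hroot : ∀ᵐ ω ∂P, ∀ᶠ n : ℕ in atTop,
      ∑ s ∈ Finset.range n, Ψ (ξ s ω) (dhat n ω) = 0 ∧
      ∀ d, ∑ s ∈ Finset.range n, Ψ (ξ s ω) d = 0 → ‖dhat n ω - c n ω‖ ≤ ‖d - c n ω‖) :
    (∀ᵐ ω ∂P, Tendsto (fun n => dhat n ω) atTop (𝓝 0)) ∧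
    TendstoInDistribution (fun (n : ℕ) ω => √(n : ℝ) • dhat n ω) atTop (id : E → E)
      (fun _ => P) ν := by
  have hprob : IsProbabilityMeasure μ := (hlaw 0).isProbabilityMeasure_iff.1 inferInstance
  have hslA := strong_law_of_hasLaw hlaw hindep hA hAint
  have hslb := strong_law_of_hasLaw hlaw hindep hΨ (hΨ2.integrable one_le_two)
  rw [hAmean] at hslA
  rw [hΨmean] at hslb
  set Abar : ℕ → Ω → E →L[ℝ] E := fun n ω => (n : ℝ)⁻¹ • ∑ i ∈ Finset.range n, A (ξ i ω)
  set F : ℕ → Ω → E → E := fun n ω d => (n : ℝ)⁻¹ • ∑ i ∈ Finset.range n, Ψ (ξ i ω) d with hF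
  have hlip : ∀ n : ℕ, 0 < n → ∀ ω d d', ‖F n ω d - F n ω d' + (d - d')‖ ≤
      (‖Abar n ω - ContinuousLinearMap.id ℝ E‖ + K * max ‖d‖ ‖d'‖) * ‖d - d'‖ := by
    intro n hn ω d d'
    have := norm_average_add_le (fun i => happrox (ξ i ω) d d') (Finset.range n)
      (Finset.nonempty_range_iff.2 hn.ne')
    simpa using this
  have hF0 : ∀ (n : ℕ), 0 < n → ∀ ω d, F n ω d = 0 ↔ ∑ i ∈ Finset.range n, Ψ (ξ i ω) d = 0 := by
    intro n hn ω d
    simp [hF, hn.ne']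
  have hε : ∀ᵐ ω ∂P, Tendsto (fun n => ‖Abar n ω - ContinuousLinearMap.id ℝ E‖) atTop (𝓝 0) := by
    filter_upwards [hslA] with ω h
    exact tendsto_iff_norm_sub_tendsto_zero.1 h
  have hb : ∀ᵐ ω ∂P, Tendsto (fun n => ‖F n ω 0‖) atTop (𝓝 0) := by
    filter_upwards [hslb] with ω h
    simpa using h.norm
  have hcons : ∀ᵐ ω ∂P, Tendsto (fun n => dhat n ω) atTop (𝓝 0) := by
    filter_upwards [hε, hb, hc, hroot] with ω h1 h2 h3 h4
    -- The zero `d` near the origin competes with `dhat`, so `‖dhat‖ ≤ ‖dhat - c‖ + ‖c‖ ≤ ‖d - c‖ +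
    -- ‖c‖ ≤ ‖d‖ + 2‖c‖`.
    have hbound : ∀ᶠ n : ℕ in atTop, ‖dhat n ω‖ ≤ 2 * ‖F n ω 0‖ + 2 * ‖c n ω‖ := by
      have h5 : Tendsto (fun n => ‖Abar n ω - ContinuousLinearMap.id ℝ E‖ +
          K * (2 * ‖F n ω 0‖)) atTop (𝓝 0) := by
        simpa using h1.add ((h2.const_mul 2).const_mul K)
      filter_upwards [h4, h5.eventually_le_const (show (0 : ℝ) < 1 / 2 by norm_num),
        eventually_gt_atTop 0] with n h4 h5 hn
      obtain ⟨d, hd, hd0⟩ := exists_zero_of_approx_id (H := fun d => -F n ω d) (by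
        intro x hx y hy
        have h6 := hlip n hn ω x y
        rw [show -F n ω x - -F n ω y - (x - y) = -(F n ω x - F n ω y + (x - y)) by abel, norm_neg]
        refine h6.trans (mul_le_mul_of_nonneg_right (le_trans ?_ h5) (norm_nonneg _))
        gcongr
        simp only [norm_neg, Metric.mem_closedBall, dist_zero_right] at hx hy
        exact max_le hx hy)
      rw [norm_neg] at hd
      have h7 := h4.2 d ((hF0 n hn ω d).1 (neg_eq_zero.1 hd0))
      have h8 := norm_sub_norm_le (dhat n ω) (c n ω)
      have h9 := norm_sub_le d (c n ω)
      linarith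
    refine squeeze_zero_norm' hbound ?_
    simpa using (h2.const_mul 2).add (h3.norm.const_mul 2)
  refine ⟨hcons, ?_⟩
  have hmap := (hlaw 0).map_eq
  have hclt := tendstoInDistribution_inv_sqrt_smul_sum (P := P) (V := fun s ω => Ψ (ξ s ω) 0) hν
    (by
      have : MemLp ((fun x => Ψ x 0) ∘ ξ 0) 2 P :=
        (memLp_map_measure_iff (by rw [hmap]; exact hΨ2.1) (hlaw 0).aemeasurable).1
          (by rwa [hmap])
      exact this)
    (by
      refine Eq.trans ?_ hΨmean
      rw [← hmap, integral_map (hlaw 0).aemeasurable]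
      rw [hmap]; exact hΨ2.1)
    (by
      intro t
      rw [← hq t, ← hmap, integral_map (hlaw 0).aemeasurable]
      exact Measurable.aestronglyMeasurable (by fun_prop))
    (hindep.comp (fun _ x => Ψ x 0) fun _ => hΨ)
    (fun i => ((hlaw i).identDistrib (hlaw 0)).comp hΨ)
  have hAm : ∀ n, AEMeasurable (Abar n) P := fun n => by
    have hs : AEMeasurable (fun ω => ∑ i ∈ Finset.range n, A (ξ i ω)) P :=
      Finset.aemeasurable_fun_sum _ fun k _ => hA.comp_aemeasurable (hlaw k).aemeasurable
    exact hs.const_smul ((n : ℝ)⁻¹)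
  -- The factor 2 arises because the linearization error is at most `(η/2)‖dhat‖`, while eventually
  -- `‖dhat‖ ≤ 2‖F 0‖`.
  let η : ℕ → Ω → ℝ := fun n ω =>
    2 * (‖Abar n ω - ContinuousLinearMap.id ℝ E‖ + K * ‖dhat n ω‖)
  have hηm : ∀ n, AEMeasurable (η n) P := fun n =>
    ((((hAm n).sub_const _).norm).add ((hdhat n).norm.const_mul _)).const_mul _
  have hη0 : ∀ᵐ ω ∂P, Tendsto (fun n => η n ω) atTop (𝓝 0) := by
    filter_upwards [hε, hcons] with ω h1 h2
    simpa [η] using (h1.add (h2.norm.const_mul K)).const_mul 2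
  have hsm := tendstoInMeasure_smul_zero hclt hηm hη0
  set X : ℕ → Ω → E := fun n ω => (√(n : ℝ))⁻¹ • ∑ k ∈ Finset.range n, Ψ (ξ k ω) 0 with hX
  have hXm := hclt.forall_aemeasurable
  have hdm : ∀ n : ℕ, AEMeasurable (fun ω => √(n : ℝ) • dhat n ω) P := fun n =>
    (hdhat n).const_smul _
  refine tendstoInDistribution_of_tendstoInMeasure_sub _ _ hclt ?_ hdm
  -- The remainder is eventually bounded by `η n • X n`.
  let ex : ℕ → Ω → ℝ := fun n ω => max (‖√(n : ℝ) • dhat n ω - X n ω‖ - ‖η n ω • X n ω‖) 0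
  have hexm : ∀ n, AEMeasurable (ex n) P := fun n =>
    ((((hdm n).sub (hXm n)).norm).sub (((hηm n).smul (hXm n)).norm)).max aemeasurable_const
  -- The bound holds only from some `ω`-dependent index on. The positive excess `ex` is then
  -- eventually zero for almost every `ω`, hence null in probability.
  have hex0 : ∀ᵐ ω ∂P, Tendsto (fun n => ex n ω) atTop (𝓝 0) := by
    filter_upwards [hη0, hroot] with ω h1 h2
    refine tendsto_const_nhds.congr' ?_
    filter_upwards [h1.eventually_le_const (show (0 : ℝ) < 1 by norm_num), h2,
      eventually_gt_atTop 0] with n h1 h2 hn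
    have hn' : (0 : ℝ) < n := by exact_mod_cast hn
    have h3 := hlip n hn ω (dhat n ω) 0
    rw [(hF0 n hn ω _).2 h2.1] at h3
    simp only [zero_sub, sub_zero, norm_zero, norm_nonneg, max_eq_left] at h3
    rw [neg_add_eq_sub] at h3
    have h4 : (‖Abar n ω - ContinuousLinearMap.id ℝ E‖ + K * ‖dhat n ω‖) = η n ω / 2 := by
      simp [η]
    rw [h4] at h3
    have h5 : ‖dhat n ω‖ ≤ 2 * ‖F n ω 0‖ := by
      have := norm_sub_norm_le (dhat n ω) (F n ω 0)
      have h6 : η n ω / 2 * ‖dhat n ω‖ ≤ 1 / 2 * ‖dhat n ω‖ := by gcongr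
      linarith
    have hη : 0 ≤ η n ω := by positivity
    have h6 : X n ω = √(n : ℝ) • F n ω 0 := by
      simp only [hX, hF, smul_smul]
      congr 1
      rw [← div_eq_mul_inv, Real.sqrt_div_self']
      simp
    rw [eq_comm]
    simp only [ex]
    rw [max_eq_right]
    rw [h6, ← smul_sub, smul_comm (η n ω), norm_smul, norm_smul _ (η n ω • F n ω 0), norm_smul,
      ← mul_sub]
    refine mul_nonpos_of_nonneg_of_nonpos (norm_nonneg _) ?_
    rw [Real.norm_of_nonneg hη]
    nlinarith
  have hexM : TendstoInMeasure P ex atTop (fun _ => (0 : ℝ)) :=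
    tendstoInMeasure_of_tendsto_ae (fun n => (hexm n).aestronglyMeasurable) hex0
  rw [tendstoInMeasure_iff_norm] at hexM hsm ⊢
  intro ε hε
  have h1 := (hexM (ε / 2) (by positivity)).add (hsm (ε / 2) (by positivity))
  rw [add_zero] at h1
  refine tendsto_of_tendsto_of_tendsto_of_le_of_le tendsto_const_nhds h1 (fun _ => zero_le) ?_
  intro n
  refine (measure_mono ?_).trans (measure_union_le _ _)
  intro ω hω
  by_contra hcon
  simp only [Set.mem_union, Set.mem_ofPred_eq, not_or, not_le, Pi.zero_apply, sub_zero,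
    Pi.sub_apply] at hcon hω
  have h2 : ‖√(n : ℝ) • dhat n ω - X n ω‖ - ‖η n ω • X n ω‖ ≤ ex n ω := le_max_left _ _
  have h3 := (le_abs_self (ex n ω)).trans_lt hcon.1
  linarith [hcon.2]

end Estimation

/-! ### Moments of the uniform distribution on the hemisphere -/

/-- Integration of a homogeneous function against `exp (-‖x‖²)` in polar coordinates. -/
theorem integral_homogeneous_mul_exp {k : ℕ} {f : E3 → ℝ} {h : Sph → ℝ}
    (hf : ∀ (u : Sph) (r : ℝ), 0 < r → f (r • (u : E3)) = r ^ k * h u) :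
    ∫ x, f x * Real.exp (-‖x‖ ^ 2) = (∫ u, h u ∂(volume : Measure E3).toSphere) *
      ∫ r in Set.Ioi (0 : ℝ), r ^ (k + 2) * Real.exp (-r ^ 2) := by
  have hdim : Module.finrank ℝ E3 - 1 = 2 := by simp
  calc
    ∫ x, f x * Real.exp (-‖x‖ ^ 2)
      = ∫ x : ({(0)}ᶜ : Set E3), f x.1 * Real.exp (-‖x.1‖ ^ 2) ∂((volume : Measure E3).comap (↑)) := by
        rw [integral_subtype_comap (measurableSet_singleton _).compl
          fun x : E3 => f x * Real.exp (-‖x‖ ^ 2), restrict_compl_singleton]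
    _ = ∫ x : Sph × Set.Ioi (0 : ℝ), h x.1 * ((x.2 : ℝ) ^ k * Real.exp (-(x.2 : ℝ) ^ 2))
          ∂((volume : Measure E3).toSphere.prod (Measure.volumeIoiPow 2)) := by
        rw [← hdim, ← (Measure.measurePreserving_homeomorphUnitSphereProd
          (volume : Measure E3)).integral_comp (Homeomorph.measurableEmbedding _)]
        refine integral_congr_ae (ae_of_all _ fun x => ?_)
        obtain ⟨y, rfl⟩ := (homeomorphUnitSphereProd E3).symm.surjective x
        obtain ⟨u, r, hr⟩ := y
        have hr' : (0 : ℝ) < r := hr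
        have hval : (((homeomorphUnitSphereProd E3).symm (u, ⟨r, hr⟩) : ({(0)}ᶜ : Set E3)) : E3) =
          r • (u : E3) := rfl
        simp only [Homeomorph.apply_symm_apply, hval, hf u r hr', norm_smul,
          Real.norm_of_nonneg hr'.le, norm_eq_of_mem_sphere]
        ring_nf
    _ = (∫ u, h u ∂(volume : Measure E3).toSphere) *
          ∫ r : Set.Ioi (0 : ℝ), (r : ℝ) ^ k * Real.exp (-(r : ℝ) ^ 2)
            ∂(Measure.volumeIoiPow 2) :=
        integral_prod_mul h fun r : Set.Ioi (0 : ℝ) => (r : ℝ) ^ k * Real.exp (-(r : ℝ) ^ 2)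
    _ = _ := by
        congr 1
        simp only [Measure.volumeIoiPow, ENNReal.ofReal]
        rw [integral_withDensity_eq_integral_smul
            ((measurable_subtype_coe.pow_const _).real_toNNReal),
          integral_subtype_comap measurableSet_Ioi
            fun a : ℝ => Real.toNNReal (a ^ 2) • (a ^ k * Real.exp (-a ^ 2))]
        refine setIntegral_congr_fun measurableSet_Ioi fun x hx => ?_
        simp only [NNReal.smul_def, smul_eq_mul]
        rw [Real.coe_toNNReal _ (pow_nonneg (le_of_lt hx) _)]
        ring

theorem integral_Ioi_pow_mul_exp (k : ℕ) :
    ∫ r in Set.Ioi (0 : ℝ), r ^ k * Real.exp (-r ^ 2) = Real.Gamma ((k + 1) / 2) / 2 := by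
  have h := integral_rpow_mul_exp_neg_rpow (p := 2) (q := k) two_pos
    (by have := Nat.cast_nonneg (α := ℝ) k; linarith)
  rw [show Real.Gamma (((k : ℝ) + 1) / 2) / 2 = 1 / 2 * Real.Gamma (((k : ℝ) + 1) / 2) by ring, ← h]
  refine setIntegral_congr_fun measurableSet_Ioi fun x hx => ?_
  simp

theorem Gamma_three_half : Real.Gamma (3 / 2) = √Real.pi / 2 := by
  rw [show (3 / 2 : ℝ) = 1 / 2 + 1 by norm_num, Real.Gamma_add_one (by norm_num),
    Real.Gamma_one_half_eq]
  ring

theorem Gamma_five_half : Real.Gamma (5 / 2) = 3 * √Real.pi / 4 := by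
  rw [show (5 / 2 : ℝ) = 3 / 2 + 1 by norm_num, Real.Gamma_add_one (by norm_num),
    Gamma_three_half]
  ring

theorem integral_pow_mul_exp_of_odd {k : ℕ} (hk : Odd k) :
    ∫ r : ℝ, r ^ k * Real.exp (-r ^ 2) = 0 := by
  have h := integral_neg_eq_self (fun r : ℝ => r ^ k * Real.exp (-r ^ 2)) volume
  simp only [hk.neg_pow, neg_mul, integral_neg, even_two.neg_pow] at h
  linarith

theorem integral_pow_mul_exp_of_even {k : ℕ} (hk : Even k) :
    ∫ r : ℝ, r ^ k * Real.exp (-r ^ 2) = Real.Gamma ((k + 1) / 2) := by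
  have h := integral_comp_abs (f := fun r : ℝ => r ^ k * Real.exp (-r ^ 2))
  simp only [hk.pow_abs, even_two.pow_abs] at h
  rw [h, integral_Ioi_pow_mul_exp]
  ring

/-- The set of unit vectors with nonnegative vertical coordinate. -/
def hemi : Set Sph := {u : Sph | 0 ≤ (u : E3) 2}

theorem measurableSet_hemi : MeasurableSet hemi :=
  measurableSet_le measurable_const (by fun_prop)

/-- The integral of the monomial times `exp (-‖x‖²)` over the upper half-space is computed twice: in
polar coordinates and, by Fubini, as a product of one-dimensional integrals. -/
theorem setIntegral_hemi_monomial (a b c : ℕ) :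
    (∫ u in hemi, ((u : E3) 0 ^ a * (u : E3) 1 ^ b * (u : E3) 2 ^ c)
        ∂(volume : Measure E3).toSphere) * (Real.Gamma ((a + b + c + 3) / 2) / 2) =
      (∫ r : ℝ, r ^ a * Real.exp (-r ^ 2)) * (∫ r : ℝ, r ^ b * Real.exp (-r ^ 2)) *
        (Real.Gamma ((c + 1) / 2) / 2) := by
  have h1 := integral_homogeneous_mul_exp (k := a + b + c)
    (f := fun x : E3 => if 0 ≤ x 2 then x 0 ^ a * x 1 ^ b * x 2 ^ c else 0)
    (h := hemi.indicator fun u : Sph => (u : E3) 0 ^ a * (u : E3) 1 ^ b * (u : E3) 2 ^ c) (by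
      intro u r hr
      have hiff : 0 ≤ (r • (u : E3)) 2 ↔ 0 ≤ (u : E3) 2 := by
        rw [PiLp.smul_apply, smul_eq_mul, mul_nonneg_iff_of_pos_left hr]
      by_cases hu : 0 ≤ (u : E3) 2
      · rw [if_pos (hiff.2 hu), Set.indicator_of_mem (show u ∈ hemi from hu)]
        simp only [PiLp.smul_apply, smul_eq_mul]
        ring
      · rw [if_neg (hiff.not.2 hu), Set.indicator_of_notMem (show u ∉ hemi from hu), mul_zero])
  rw [integral_indicator measurableSet_hemi, integral_Ioi_pow_mul_exp] at h1
  push_cast at h1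
  rw [show (a + b + c + 3 : ℝ) = a + b + c + 2 + 1 by ring, ← h1,
    ← (PiLp.volume_preserving_toLp (Fin 3)).integral_comp
      (MeasurableEquiv.toLp 2 (Fin 3 → ℝ)).measurableEmbedding]
  let F : Fin 3 → ℝ → ℝ := ![fun r => r ^ a * Real.exp (-r ^ 2), fun r => r ^ b * Real.exp (-r ^ 2),
    (Set.Ici 0).indicator fun r => r ^ c * Real.exp (-r ^ 2)]
  have h2 := integral_fintype_prod_volume_eq_prod F
  simp only [Fin.prod_univ_three] at h2
  have h3 : ∫ r, F 2 r = Real.Gamma ((c + 1) / 2) / 2 := by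
    simp only [F, Matrix.cons_val]
    rw [integral_indicator measurableSet_Ici, integral_Ici_eq_integral_Ioi,
      integral_Ioi_pow_mul_exp]
  rw [h3] at h2
  refine Eq.trans ?_ h2
  refine integral_congr_ae (ae_of_all _ fun x => ?_)
  simp only [EuclideanSpace.real_norm_sq_eq, Fin.sum_univ_three, F, Matrix.cons_val]
  by_cases hx : 0 ≤ x 2
  · rw [if_pos hx, Set.indicator_of_mem (show x 2 ∈ Set.Ici 0 from hx), neg_add, neg_add,
      Real.exp_add, Real.exp_add]
    ring
  · rw [if_neg hx, Set.indicator_of_notMem (show x 2 ∉ Set.Ici 0 from hx)]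
    ring

theorem measureReal_hemi : (volume : Measure E3).toSphere.real hemi = 2 * Real.pi := by
  have h := setIntegral_hemi_monomial 0 0 0
  rw [integral_pow_mul_exp_of_even Even.zero] at h
  simp only [pow_zero, mul_one, integral_const, smul_eq_mul, measureReal_restrict_apply_univ] at h
  norm_num [Real.Gamma_one_half_eq, Gamma_three_half] at h
  have hp : 0 < √Real.pi := Real.sqrt_pos.2 Real.pi_pos
  have hs : √Real.pi * √Real.pi = Real.pi := Real.mul_self_sqrt Real.pi_pos.le
  rw [hs] at h
  field_simp at h
  linarith

instance : IsProbabilityMeasure hemisphereUniform := by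
  refine cond_isProbabilityMeasure_of_finite (fun h => ?_) (measure_ne_top _ _)
  have h2 := measureReal_hemi
  rw [measureReal_def, show hemi = {u : Sph | 0 ≤ (u : E3) 2} from rfl, h] at h2
  simp [Real.pi_ne_zero] at h2

theorem integral_hemisphereUniform (f : Sph → ℝ) :
    ∫ u, f u ∂hemisphereUniform =
      (2 * Real.pi)⁻¹ * ∫ u in hemi, f u ∂(volume : Measure E3).toSphere := by
  rw [hemisphereUniform, ProbabilityTheory.cond, integral_smul_measure, ENNReal.toReal_inv,
    ← measureReal_hemi]
  rfl

/-- The mixed moments of the uniform distribution on the hemisphere. -/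
theorem integral_hemisphereUniform_monomial (a b c : ℕ) :
    (∫ u, ((u : E3) 0 ^ a * (u : E3) 1 ^ b * (u : E3) 2 ^ c) ∂hemisphereUniform) *
        (2 * Real.pi * Real.Gamma ((a + b + c + 3) / 2)) =
      (∫ r : ℝ, r ^ a * Real.exp (-r ^ 2)) * (∫ r : ℝ, r ^ b * Real.exp (-r ^ 2)) *
        Real.Gamma ((c + 1) / 2) := by
  have h := setIntegral_hemi_monomial a b c
  rw [integral_hemisphereUniform]
  have := Real.pi_pos
  field_simp
  linarith

theorem integral_monomial_eq_zero {a b c : ℕ} (h : Odd a ∨ Odd b) :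
    ∫ u, ((u : E3) 0 ^ a * (u : E3) 1 ^ b * (u : E3) 2 ^ c) ∂hemisphereUniform = 0 := by
  have h1 := integral_hemisphereUniform_monomial a b c
  have h2 : (∫ r : ℝ, r ^ a * Real.exp (-r ^ 2)) * (∫ r : ℝ, r ^ b * Real.exp (-r ^ 2)) = 0 := by
    rcases h with h | h <;> simp [integral_pow_mul_exp_of_odd h]
  rw [h2, zero_mul] at h1
  have h3 : 0 < Real.Gamma ((a + b + c + 3 : ℝ) / 2) := Real.Gamma_pos_of_pos (by positivity)
  exact (mul_eq_zero.1 h1).resolve_right (by positivity)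

theorem integral_vertical : ∫ u : Sph, (u : E3) 2 ∂hemisphereUniform = 1 / 2 := by
  have h := integral_hemisphereUniform_monomial 0 0 1
  rw [integral_pow_mul_exp_of_even Even.zero] at h
  norm_num [Real.Gamma_one_half_eq] at h
  rw [Real.mul_self_sqrt Real.pi_pos.le] at h
  have := Real.pi_pos
  field_simp at h
  linarith

theorem integral_sq_zero : ∫ u : Sph, (u : E3) 0 ^ 2 ∂hemisphereUniform = 1 / 3 := by
  have h := integral_hemisphereUniform_monomial 2 0 0
  rw [integral_pow_mul_exp_of_even even_two, integral_pow_mul_exp_of_even Even.zero] at h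
  norm_num [Real.Gamma_one_half_eq, Gamma_three_half, Gamma_five_half] at h
  have hp : 0 < √Real.pi := Real.sqrt_pos.2 Real.pi_pos
  have hs : √Real.pi ^ 2 = Real.pi := Real.sq_sqrt Real.pi_pos.le
  have := Real.pi_pos
  field_simp at h
  rw [hs] at h
  nlinarith

theorem integral_sq_one : ∫ u : Sph, (u : E3) 1 ^ 2 ∂hemisphereUniform = 1 / 3 := by
  have h := integral_hemisphereUniform_monomial 0 2 0
  rw [integral_pow_mul_exp_of_even even_two, integral_pow_mul_exp_of_even Even.zero] at h
  norm_num [Real.Gamma_one_half_eq, Gamma_three_half, Gamma_five_half] at h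
  have hp : 0 < √Real.pi := Real.sqrt_pos.2 Real.pi_pos
  have hs : √Real.pi ^ 2 = Real.pi := Real.sq_sqrt Real.pi_pos.le
  have := Real.pi_pos
  field_simp at h
  rw [hs] at h
  nlinarith

theorem integral_sq_two : ∫ u : Sph, (u : E3) 2 ^ 2 ∂hemisphereUniform = 1 / 3 := by
  have h := integral_hemisphereUniform_monomial 0 0 2
  rw [integral_pow_mul_exp_of_even Even.zero] at h
  norm_num [Real.Gamma_one_half_eq, Gamma_three_half, Gamma_five_half] at h
  have hp : 0 < √Real.pi := Real.sqrt_pos.2 Real.pi_pos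
  have hs : √Real.pi ^ 2 = Real.pi := Real.sq_sqrt Real.pi_pos.le
  have := Real.pi_pos
  field_simp at h
  rw [hs] at h
  nlinarith

/-- The second moment matrix of the design row, the inverse of `Qmat`. -/
def gramMean : Matrix (Fin 4) (Fin 4) ℝ :=
  !![1 / 3, 0, 0, 0;
     0, 1 / 3, 0, 0;
     0, 0, 1 / 3, -1 / 2;
     0, 0, -1 / 2, 1]

theorem gramMean_mul_Qmat : gramMean * Qmat = 1 := by
  ext i j
  simp only [Matrix.mul_apply, Fin.sum_univ_four]
  fin_cases i <;> fin_cases j <;> simp [gramMean, Qmat] <;> norm_num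

theorem Qmat_mul_gramMean : Qmat * gramMean = 1 := mul_eq_one_comm.1 gramMean_mul_Qmat

theorem integral_designRow_mul (i j : Fin 4) :
    ∫ u, designRow u i * designRow u j ∂hemisphereUniform = gramMean i j := by
  have h0 := integral_monomial_eq_zero (a := 1) (b := 0) (c := 0) (Or.inl odd_one)
  have h1 := integral_monomial_eq_zero (a := 0) (b := 1) (c := 0) (Or.inr odd_one)
  have h01 := integral_monomial_eq_zero (a := 1) (b := 1) (c := 0) (Or.inl odd_one)
  have h02 := integral_monomial_eq_zero (a := 1) (b := 0) (c := 1) (Or.inl odd_one)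
  have h12 := integral_monomial_eq_zero (a := 0) (b := 1) (c := 1) (Or.inr odd_one)
  have h00 := integral_sq_zero
  have h11 := integral_sq_one
  have h22 := integral_sq_two
  have h2 := integral_vertical
  simp only [pow_one, pow_zero, mul_one, one_mul, sq] at h0 h1 h01 h02 h12 h00 h11 h22
  fin_cases i <;> fin_cases j <;>
    simp [designRow, gramMean, integral_neg, h0, h1, h2, h00, h11, h22, h01, h02, h12,
      mul_comm ((_ : E3) 1) ((_ : E3) 0), mul_comm ((_ : E3) 2) ((_ : E3) 0),
      mul_comm ((_ : E3) 2) ((_ : E3) 1)]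
  all_goals norm_num

/-! ### Posterior moments of an ambiguity and their derivatives -/

section Posterior

/-- The unnormalized posterior moment of order `k` of an ambiguity given the residual `x`. -/
def postSum (M : ℕ) (lam σt : ℝ) (k : ℕ) (x : ℝ) : ℝ :=
  ∑ j ∈ Finset.Icc (-(M : ℤ)) (M : ℤ),
    (j : ℝ) ^ k * Real.exp (-(1 / (2 * σt ^ 2)) * (x - lam * (j : ℝ)) ^ 2)

/-- The posterior moment of order `k` of an ambiguity given the residual `x`. -/
def postMean (M : ℕ) (lam σt : ℝ) (k : ℕ) (x : ℝ) : ℝ :=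
  postSum M lam σt k x / postSum M lam σt 0 x

/-- The residual `x` corrected by the posterior mean of the ambiguity. -/
def corrected (M : ℕ) (lam σt : ℝ) (x : ℝ) : ℝ := x - lam * postMean M lam σt 1 x

/-- The derivative of `corrected`. -/
def correctedSlope (M : ℕ) (lam σt : ℝ) (x : ℝ) : ℝ :=
  1 - (lam / σt) ^ 2 * (postMean M lam σt 2 x - postMean M lam σt 1 x ^ 2)

variable (M : ℕ) (lam σt : ℝ)

theorem postSum_zero_pos (x : ℝ) : 0 < postSum M lam σt 0 x := by
  refine Finset.sum_pos (fun j _ => ?_) ⟨0, by simp⟩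
  positivity

theorem ambiguityMMSE_eq {S : ℕ} (G : Matrix (Fin S) (Fin 4) ℝ) (yt : Fin S → ℝ) (v : E4)
    (s : Fin S) :
    ambiguityMMSE M lam σt G yt v s = postMean M lam σt 1 (yt s - (G *ᵥ v.ofLp) s) := by
  simp [ambiguityMMSE, postMean, postSum]

variable {σt} in
-- At the true parameter the carrier-phase residual is `λ n + σ̃ z`; dividing it by `σ̃` gives the
-- normalized form used in `hFactor`.
theorem posteriorMoment_eq (hσt : σt ≠ 0) (k : ℕ) (n : ℤ) (z : ℝ) :
    posteriorMoment M k (lam / σt) n z = postMean M lam σt k (lam * n + σt * z) := by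
  have h : ∀ j : ℤ, -(1 / 2) * (lam / σt * ((j : ℝ) - (n : ℝ)) - z) ^ 2 =
      -(1 / (2 * σt ^ 2)) * (lam * n + σt * z - lam * (j : ℝ)) ^ 2 := by
    intro j
    field_simp
    ring
  simp only [posteriorMoment, postMean, postSum, h, pow_zero, one_mul]

theorem abs_postMean_le (k : ℕ) (x : ℝ) : |postMean M lam σt k x| ≤ (M : ℝ) ^ k := by
  rw [postMean, abs_div, abs_of_pos (postSum_zero_pos M lam σt x),
    div_le_iff₀ (postSum_zero_pos M lam σt x), postSum, postSum, Finset.mul_sum]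
  refine Finset.abs_sum_le_sum_abs _ _ |>.trans (Finset.sum_le_sum fun j hj => ?_)
  rw [abs_mul, abs_of_pos (Real.exp_pos _), pow_zero, one_mul, abs_pow]
  have h : |(j : ℝ)| ≤ M := by
    rw [Finset.mem_Icc] at hj
    rw [abs_le]
    exact ⟨by exact_mod_cast hj.1, by exact_mod_cast hj.2⟩
  gcongr

theorem hasDerivAt_postSum (k : ℕ) (x : ℝ) :
    HasDerivAt (postSum M lam σt k) ((lam * postSum M lam σt (k + 1) x -
      x * postSum M lam σt k x) / σt ^ 2) x := by
  have h : ∀ j ∈ Finset.Icc (-(M : ℤ)) (M : ℤ), HasDerivAt (fun x : ℝ =>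
      (j : ℝ) ^ k * Real.exp (-(1 / (2 * σt ^ 2)) * (x - lam * (j : ℝ)) ^ 2))
      ((j : ℝ) ^ k * (Real.exp (-(1 / (2 * σt ^ 2)) * (x - lam * (j : ℝ)) ^ 2) *
        (-(1 / (2 * σt ^ 2)) * (2 * (x - lam * (j : ℝ)))))) x := by
    intro j _
    have h1 : HasDerivAt (fun x : ℝ => (x - lam * (j : ℝ)) ^ 2) (2 * (x - lam * (j : ℝ))) x := by
      simpa using ((hasDerivAt_id x).sub_const (lam * (j : ℝ))).fun_pow 2
    exact ((h1.const_mul _).exp).const_mul _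
  refine (HasDerivAt.fun_sum h).congr_deriv ?_
  simp only [postSum]
  rw [Finset.mul_sum, Finset.mul_sum, ← Finset.sum_sub_distrib, Finset.sum_div]
  refine Finset.sum_congr rfl fun j _ => ?_
  -- Division by zero is zero, so both sides vanish and `σt ≠ 0` need not be assumed.
  by_cases hσ : σt = 0
  · simp [hσ]
  · field_simp
    ring

/-- Moving `x` tilts the posterior exponentially, so the derivative is `λ/σ̃²` times the posterior
covariance of `jᵏ` and `j`. For `k = 1` this is the variance that appears in `correctedSlope`. -/
theorem hasDerivAt_postMean (k : ℕ) (x : ℝ) :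
    HasDerivAt (postMean M lam σt k) (lam / σt ^ 2 * (postMean M lam σt (k + 1) x -
      postMean M lam σt k x * postMean M lam σt 1 x)) x := by
  have h0 := (postSum_zero_pos M lam σt x).ne'
  refine ((hasDerivAt_postSum M lam σt k x).div (hasDerivAt_postSum M lam σt 0 x) h0).congr_deriv ?_
  simp only [postMean]
  by_cases hσ : σt = 0
  · simp [hσ]
  · field_simp
    ring

theorem hasDerivAt_corrected (x : ℝ) :
    HasDerivAt (corrected M lam σt) (correctedSlope M lam σt x) x := by
  refine ((hasDerivAt_id x).sub ((hasDerivAt_postMean M lam σt 1 x).const_mul lam)).congr_deriv ?_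
  rw [correctedSlope]
  ring

theorem continuous_postMean (k : ℕ) : Continuous (postMean M lam σt k) :=
  continuous_iff_continuousAt.2 fun x => (hasDerivAt_postMean M lam σt k x).continuousAt

@[fun_prop]
theorem continuous_corrected : Continuous (corrected M lam σt) :=
  continuous_iff_continuousAt.2 fun x => (hasDerivAt_corrected M lam σt x).continuousAt

@[fun_prop]
theorem continuous_correctedSlope : Continuous (correctedSlope M lam σt) :=
  continuous_const.sub (continuous_const.mul
    ((continuous_postMean M lam σt 2).sub ((continuous_postMean M lam σt 1).pow 2)))

theorem abs_corrected_le (x : ℝ) : |corrected M lam σt x| ≤ |x| + |lam| * M := by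
  refine (abs_sub _ _).trans ?_
  rw [abs_mul]
  have := abs_postMean_le M lam σt 1 x
  rw [pow_one] at this
  gcongr

theorem exists_abs_correctedSlope_le : ∃ C, 0 ≤ C ∧ ∀ x, |correctedSlope M lam σt x| ≤ C := by
  refine ⟨1 + (lam / σt) ^ 2 * ((M : ℝ) ^ 2 + (M : ℝ) ^ 2), by positivity, fun x => ?_⟩
  refine (abs_sub _ _).trans ?_
  rw [abs_one, abs_mul, abs_of_nonneg (sq_nonneg (lam / σt))]
  have h1 := abs_postMean_le M lam σt 1 x
  rw [pow_one] at h1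
  gcongr
  refine (abs_sub _ _).trans (add_le_add (abs_postMean_le M lam σt 2 x) ?_)
  rw [abs_pow]
  gcongr

theorem exists_lipschitz_correctedSlope : ∃ C, 0 ≤ C ∧
    ∀ x y, |correctedSlope M lam σt x - correctedSlope M lam σt y| ≤ C * |x - y| := by
  let D : ℝ → ℝ := fun x => -((lam / σt) ^ 2 * (lam / σt ^ 2 * (postMean M lam σt 3 x -
      postMean M lam σt 2 x * postMean M lam σt 1 x) - 2 * postMean M lam σt 1 x *
      (lam / σt ^ 2 * (postMean M lam σt 2 x - postMean M lam σt 1 x * postMean M lam σt 1 x))))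
  have hD : ∀ x, HasDerivAt (correctedSlope M lam σt) (D x) x := by
    intro x
    refine ((((hasDerivAt_postMean M lam σt 2 x).sub
      ((hasDerivAt_postMean M lam σt 1 x).pow 2)).const_mul ((lam / σt) ^ 2)).const_sub
        1).congr_deriv ?_
    simp only [D]
    ring
  -- `C` bounds `|D|` termwise, each posterior moment of order `k` being at most `Mᵏ` in absolute
  -- value.
  let C : ℝ := (lam / σt) ^ 2 * (|lam / σt ^ 2| * ((M : ℝ) ^ 3 + (M : ℝ) ^ 2 * M) +
    2 * M * (|lam / σt ^ 2| * ((M : ℝ) ^ 2 + M * M)))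
  have hC : 0 ≤ C := by positivity
  refine ⟨C, hC, fun x y => ?_⟩
  refine Convex.norm_image_sub_le_of_norm_hasDerivWithin_le (𝕜 := ℝ) (s := Set.univ)
    (fun x _ => (hD x).hasDerivWithinAt) (fun x _ => ?_) convex_univ (Set.mem_univ y)
    (Set.mem_univ x)
  have h1 := abs_postMean_le M lam σt 1 x
  have h2 := abs_postMean_le M lam σt 2 x
  have h3 := abs_postMean_le M lam σt 3 x
  rw [pow_one] at h1
  simp only [D, C]
  rw [norm_neg, Real.norm_eq_abs, abs_mul, abs_of_nonneg (sq_nonneg (lam / σt))]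
  gcongr
  refine (abs_sub _ _).trans (add_le_add ?_ ?_)
  · rw [abs_mul]
    gcongr
    refine (abs_sub _ _).trans (add_le_add h3 ?_)
    rw [abs_mul]
    gcongr
  · rw [abs_mul, abs_mul, abs_mul, abs_two]
    gcongr
    refine (abs_sub _ _).trans (add_le_add h2 ?_)
    rw [abs_mul]
    gcongr

/-- The linearization error of `corrected` around a point. -/
theorem exists_corrected_approx : ∃ C, 0 ≤ C ∧ ∀ x t t',
    |corrected M lam σt (x - t) - corrected M lam σt (x - t') +
      correctedSlope M lam σt x * (t - t')| ≤ C * max |t| |t'| * |t - t'| := by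
  obtain ⟨C, hC, hlip⟩ := exists_lipschitz_correctedSlope M lam σt
  refine ⟨C, hC, fun x t t' => ?_⟩
  -- With the tangent term added, the derivative is a difference of slopes, at most `C |s|`. The
  -- mean value inequality is applied on the symmetric interval that contains `t` and `t'`.
  have hg : ∀ s, HasDerivAt (fun s => corrected M lam σt (x - s) + correctedSlope M lam σt x * s)
      (correctedSlope M lam σt x - correctedSlope M lam σt (x - s)) s := by
    intro s
    refine (((hasDerivAt_corrected M lam σt (x - s)).comp s
      ((hasDerivAt_id s).const_sub x)).add ((hasDerivAt_id s).const_mul _)).congr_deriv ?_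
    ring
  have h := Convex.norm_image_sub_le_of_norm_hasDerivWithin_le (𝕜 := ℝ)
    (s := Set.Icc (-(max |t| |t'|)) (max |t| |t'|)) (x := t') (y := t)
    (C := C * max |t| |t'|)
    (fun s _ => (hg s).hasDerivWithinAt) (fun s hs => by
      refine (hlip _ _).trans ?_
      rw [sub_sub_cancel]
      exact mul_le_mul_of_nonneg_left (abs_le.2 hs) hC) (convex_Icc _ _)
    (abs_le.1 (le_max_right _ _)) (abs_le.1 (le_max_left _ _))
  refine le_of_eq_of_le ?_ h
  rw [Real.norm_eq_abs]
  congr 1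
  ring

end Posterior

/-! ### The law of the phase noise and its information identity -/

section ObservationLaw

variable (M : ℕ) (lam σt : ℝ)

theorem ambiguityPrior_eq_sum : ambiguityPrior M =
    (((2 * M + 1 : ℕ) : ENNReal)⁻¹) • ∑ n ∈ Finset.Icc (-(M : ℤ)) (M : ℤ), Measure.dirac n := by
  refine Measure.ext_of_singleton fun a => ?_
  have hcard : (Finset.Icc (-(M : ℤ)) (M : ℤ)).card = 2 * M + 1 := by
    rw [Int.card_Icc]
    omega
  rw [ambiguityPrior, ← Finset.coe_Icc, ← Finset.coe_singleton, uniformOn_apply_finset, hcard]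
  simp only [Measure.smul_apply, Measure.finsetSum_apply, smul_eq_mul,
    ENNReal.div_eq_inv_mul, Finset.coe_singleton]
  congr 1
  by_cases ha : a ∈ Finset.Icc (-(M : ℤ)) (M : ℤ)
  · rw [Finset.inter_singleton_of_mem ha, Finset.card_singleton, Finset.sum_eq_single a]
    · simp
    · intro b _ hb
      simp [hb]
    · exact fun h => absurd ha h
  · rw [Finset.inter_singleton_of_notMem ha, Finset.card_empty, Finset.sum_eq_zero]
    · simp
    · intro b hb
      have : b ≠ a := fun h => ha (h ▸ hb)
      simp [this]

instance : IsProbabilityMeasure (ambiguityPrior M) :=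
  isProbabilityMeasure_uniformOn (Set.finite_Icc _ _) ⟨0, by simp⟩

/-- The residual `λ m + σ̃ z̃` of a carrier-phase measurement at the true parameter. -/
def phaseNoise (p : ℝ × ℤ) : ℝ := lam * p.2 + σt * p.1

theorem measurable_phaseNoise : Measurable (phaseNoise lam σt) := by
  unfold phaseNoise
  have : Measurable fun n : ℤ => (n : ℝ) := measurable_from_top
  fun_prop

theorem map_phaseNoise : ((gaussianReal 0 1).prod (ambiguityPrior M)).map (phaseNoise lam σt) =
    (((2 * M + 1 : ℕ) : ENNReal)⁻¹) • ∑ n ∈ Finset.Icc (-(M : ℤ)) (M : ℤ),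
      gaussianReal (lam * n) (σt ^ 2).toNNReal := by
  ext s hs
  rw [Measure.map_apply (measurable_phaseNoise lam σt) hs,
    Measure.prod_apply_symm (measurable_phaseNoise lam σt hs), ambiguityPrior_eq_sum,
    lintegral_smul_measure, lintegral_finsetSum_measure]
  simp only [Measure.smul_apply, Measure.finsetSum_apply, lintegral_dirac]
  congr 1
  refine Finset.sum_congr rfl fun n _ => ?_
  have h : gaussianReal (lam * n) (σt ^ 2).toNNReal =
      (gaussianReal 0 1).map (fun z => lam * n + σt * z) := by
    have h1 : (fun z : ℝ => lam * n + σt * z) = (fun z => lam * n + z) ∘ fun z => σt * z := rfl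
    rw [h1, ← Measure.map_map (by fun_prop) (by fun_prop), gaussianReal_map_const_mul,
      gaussianReal_map_const_add]
    congr 1
    · ring
    · rw [mul_one]
      exact Real.toNNReal_of_nonneg (sq_nonneg _)
  rw [h, Measure.map_apply (by fun_prop) hs]
  rfl

/-- Quadratic growth is the class needed to accommodate the square of `corrected`. -/
theorem integrable_gaussianReal_of_growth {f : ℝ → ℝ} (hf : Continuous f) {C : ℝ}
    (hC : ∀ x, |f x| ≤ C * (1 + x ^ 2)) (μ : ℝ) (v : NNReal) : Integrable f (gaussianReal μ v) := by
  have h2 : Integrable (fun x : ℝ => x ^ 2) (gaussianReal μ v) :=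
    (memLp_id_gaussianReal 2).integrable_sq
  exact (((integrable_const 1).add h2).const_mul C).mono' hf.aestronglyMeasurable
    (ae_of_all _ hC)

theorem integrable_phaseNoise_of_growth {f : ℝ → ℝ} (hf : Continuous f) {C : ℝ}
    (hC : ∀ x, |f x| ≤ C * (1 + x ^ 2)) :
    Integrable (fun p => f (phaseNoise lam σt p)) ((gaussianReal 0 1).prod (ambiguityPrior M)) := by
  have h : Integrable f (((gaussianReal 0 1).prod (ambiguityPrior M)).map (phaseNoise lam σt)) := by
    rw [map_phaseNoise]
    refine Integrable.smul_measure ?_ (by simp)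
    rw [integrable_finsetSum_measure]
    exact fun n _ => integrable_gaussianReal_of_growth hf hC _ _
  exact h.comp_measurable (measurable_phaseNoise lam σt)

variable {σt}

/-- The denominator in Bayes' rule is proportional to the mixture density of the phase noise.
Expectations thus become Lebesgue integrals with a weight whose derivative is known. -/
theorem postSum_zero_eq (hσt : σt ≠ 0) (x : ℝ) : postSum M lam σt 0 x =
    √(2 * Real.pi * σt ^ 2) * ∑ n ∈ Finset.Icc (-(M : ℤ)) (M : ℤ),
      gaussianPDFReal (lam * n) (σt ^ 2).toNNReal x := by
  rw [postSum, Finset.mul_sum]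
  refine Finset.sum_congr rfl fun n _ => ?_
  have hpos : 0 < 2 * Real.pi * σt ^ 2 := by have := Real.pi_pos; positivity
  rw [gaussianPDFReal, Real.coe_toNNReal _ (sq_nonneg _), ← mul_assoc,
    mul_inv_cancel₀ (Real.sqrt_pos.2 hpos).ne', pow_zero]
  congr 2
  field_simp

theorem integrable_mul_gaussianPDFReal (hσt : σt ≠ 0) {f : ℝ → ℝ} (hf : Continuous f) {C : ℝ}
    (hC : ∀ x, |f x| ≤ C * (1 + x ^ 2)) (μ : ℝ) :
    Integrable fun x => f x * gaussianPDFReal μ (σt ^ 2).toNNReal x := by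
  have hv : (σt ^ 2).toNNReal ≠ 0 := by
    rw [Ne, Real.toNNReal_eq_zero, not_le]; positivity
  have h := integrable_gaussianReal_of_growth hf hC μ (σt ^ 2).toNNReal
  rw [gaussianReal_of_var_ne_zero _ hv, integrable_withDensity_iff_integrable_smul'
    (measurable_gaussianPDF _ _) (ae_of_all _ fun _ => gaussianPDF_lt_top)] at h
  refine h.congr (ae_of_all _ fun x => ?_)
  simp [toReal_gaussianPDF, mul_comm]

theorem integrable_mul_postSum (hσt : σt ≠ 0) {f : ℝ → ℝ} (hf : Continuous f) {C : ℝ}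
    (hC : ∀ x, |f x| ≤ C * (1 + x ^ 2)) : Integrable fun x => f x * postSum M lam σt 0 x := by
  simp only [postSum_zero_eq M lam hσt, Finset.mul_sum]
  refine integrable_finsetSum _ fun n _ => ?_
  have h := (integrable_mul_gaussianPDFReal hσt hf hC (lam * n)).const_mul (√(2 * Real.pi * σt ^ 2))
  refine h.congr (ae_of_all _ fun x => ?_)
  ring

theorem integral_phaseNoise (hσt : σt ≠ 0) {f : ℝ → ℝ} (hf : Continuous f) {C : ℝ}
    (hC : ∀ x, |f x| ≤ C * (1 + x ^ 2)) :
    ∫ p, f (phaseNoise lam σt p) ∂((gaussianReal 0 1).prod (ambiguityPrior M)) =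
      ((2 * M + 1 : ℝ) * √(2 * Real.pi * σt ^ 2))⁻¹ * ∫ x, f x * postSum M lam σt 0 x := by
  have hv : (σt ^ 2).toNNReal ≠ 0 := by
    rw [Ne, Real.toNNReal_eq_zero, not_le]; positivity
  have hpos : 0 < 2 * Real.pi * σt ^ 2 := by have := Real.pi_pos; positivity
  have hs := (Real.sqrt_pos.2 hpos).ne'
  rw [← integral_map (measurable_phaseNoise lam σt).aemeasurable hf.aestronglyMeasurable,
    map_phaseNoise, integral_smul_measure, integral_finsetSum_measure fun n _ =>
      integrable_gaussianReal_of_growth hf hC _ _]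
  have h1 : ∀ x, f x * postSum M lam σt 0 x = √(2 * Real.pi * σt ^ 2) *
      ∑ n ∈ Finset.Icc (-(M : ℤ)) (M : ℤ), f x * gaussianPDFReal (lam * n) (σt ^ 2).toNNReal x := by
    intro x
    rw [postSum_zero_eq M lam hσt, ← Finset.mul_sum]
    ring
  simp only [h1]
  rw [integral_const_mul, integral_finsetSum _ fun (n : ℤ) _ =>
    integrable_mul_gaussianPDFReal hσt hf hC (lam * n), mul_inv, mul_assoc,
    inv_mul_cancel_left₀ hs, smul_eq_mul]
  congr 1
  · rw [ENNReal.toReal_inv, ENNReal.toReal_natCast]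
    push_cast
    ring
  · refine Finset.sum_congr rfl fun n _ => ?_
    rw [integral_gaussianReal_eq_integral_smul hv]
    simp only [smul_eq_mul, mul_comm]

/-- Integration by parts against the density of the phase noise. -/
theorem integral_mul_corrected (hσt : σt ≠ 0) {f f' : ℝ → ℝ} (hf : ∀ x, HasDerivAt f (f' x) x)
    (hf' : Continuous f') {C : ℝ} (hC : ∀ x, |f x| ≤ C * (1 + x ^ 2))
    (hC' : ∀ x, |f' x| ≤ C * (1 + x ^ 2))
    (hCc : ∀ x, |f x * corrected M lam σt x| ≤ C * (1 + x ^ 2)) :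
    ∫ p, f (phaseNoise lam σt p) * corrected M lam σt (phaseNoise lam σt p)
        ∂((gaussianReal 0 1).prod (ambiguityPrior M)) =
      σt ^ 2 * ∫ p, f' (phaseNoise lam σt p) ∂((gaussianReal 0 1).prod (ambiguityPrior M)) := by
  have hfc : Continuous f := continuous_iff_continuousAt.2 fun x => (hf x).continuousAt
  have hfcc : Continuous fun x => f x * corrected M lam σt x := by fun_prop
  rw [integral_phaseNoise M lam hσt hfcc hCc, integral_phaseNoise M lam hσt hf' hC']
  -- The score identity: `-corrected / σ̃²` is the logarithmic derivative of the weight.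
  have hN : ∀ x, HasDerivAt (postSum M lam σt 0)
      (-(corrected M lam σt x * postSum M lam σt 0 x) / σt ^ 2) x := by
    intro x
    refine (hasDerivAt_postSum M lam σt 0 x).congr_deriv ?_
    have h0 := (postSum_zero_pos M lam σt x).ne'
    rw [corrected, postMean]
    field_simp
    ring
  -- By the growth bounds all products involved are integrable, so there are no boundary terms.
  have h := integral_mul_deriv_eq_deriv_mul_of_integrable (fun x _ => hf x) (fun x _ => hN x)
    (by
      refine ((integrable_mul_postSum M lam hσt hfcc hCc).const_mul (-(σt ^ 2)⁻¹)).congr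
        (ae_of_all _ fun x => ?_)
      simp only [Pi.mul_apply]
      ring)
    (integrable_mul_postSum M lam hσt hf' hC')
    (integrable_mul_postSum M lam hσt hfc hC)
  have h2 : ∀ x, f x * corrected M lam σt x * postSum M lam σt 0 x =
      -σt ^ 2 * (f x * (-(corrected M lam σt x * postSum M lam σt 0 x) / σt ^ 2)) := by
    intro x
    field_simp
  simp only [h2]
  rw [integral_const_mul, h]
  ring

theorem exists_growth_corrected : ∃ C, ∀ x, |corrected M lam σt x| ≤ C * (1 + x ^ 2) ∧
    |corrected M lam σt x * corrected M lam σt x| ≤ C * (1 + x ^ 2) ∧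
    |correctedSlope M lam σt x| ≤ C * (1 + x ^ 2) := by
  obtain ⟨D, hD, hs⟩ := exists_abs_correctedSlope_le M lam σt
  set B := |lam| * M with hBdef
  have hB : 0 ≤ B := by positivity
  refine ⟨1 + D + 2 * B + 2 * B ^ 2 + 2, fun x => ?_⟩
  have h1 := abs_corrected_le M lam σt x
  have h2 : |x| ≤ 1 + x ^ 2 := by nlinarith [sq_nonneg (|x| - 1), sq_abs x]
  have hx := sq_nonneg x
  refine ⟨by nlinarith [mul_nonneg hB hx, mul_nonneg hD hx], ?_, ?_⟩
  · rw [abs_mul, ← sq]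
    have h3 : |corrected M lam σt x| ^ 2 ≤ (|x| + B) ^ 2 := by gcongr
    have h4 : (|x| + B) ^ 2 ≤ 2 * x ^ 2 + 2 * B ^ 2 := by
      nlinarith [sq_nonneg (|x| - B), sq_abs x]
    nlinarith [mul_nonneg hB hx, mul_nonneg hD hx, mul_nonneg (sq_nonneg B) hx]
  · have := hs x
    nlinarith [mul_nonneg hB hx, mul_nonneg hD hx, mul_nonneg (sq_nonneg B) hx, sq_nonneg B]

theorem integrable_corrected :
    Integrable (fun p => corrected M lam σt (phaseNoise lam σt p))
      ((gaussianReal 0 1).prod (ambiguityPrior M)) := by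
  obtain ⟨C, hC⟩ := exists_growth_corrected M lam (σt := σt)
  exact integrable_phaseNoise_of_growth M lam σt (continuous_corrected M lam σt) fun x => (hC x).1

theorem integrable_corrected_sq :
    Integrable (fun p => corrected M lam σt (phaseNoise lam σt p) ^ 2)
      ((gaussianReal 0 1).prod (ambiguityPrior M)) := by
  obtain ⟨C, hC⟩ := exists_growth_corrected M lam (σt := σt)
  refine integrable_phaseNoise_of_growth M lam σt (f := fun x => corrected M lam σt x ^ 2)
    (C := C) (by fun_prop) fun x => ?_
  rw [sq]
  exact (hC x).2.1

/-- Integration by parts with `f = 1`: the score of a density is centred. -/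
theorem integral_corrected (hσt : σt ≠ 0) :
    ∫ p, corrected M lam σt (phaseNoise lam σt p)
      ∂((gaussianReal 0 1).prod (ambiguityPrior M)) = 0 := by
  obtain ⟨C, hC⟩ := exists_growth_corrected M lam (σt := σt)
  have h := integral_mul_corrected M lam hσt (f := fun _ => 1) (f' := fun _ => 0)
    (fun x => hasDerivAt_const x 1) continuous_const (C := |C| + 1)
    (fun x => by rw [abs_one]; nlinarith [sq_nonneg x, abs_nonneg C, mul_nonneg (abs_nonneg C) (sq_nonneg x)])
    (fun x => by rw [abs_zero]; positivity)
    (fun x => by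
      rw [one_mul]
      refine (hC x).1.trans ?_
      gcongr
      linarith [le_abs_self C])
  simpa using h

/-- `hFactor` is the mean slope of `corrected`. -/
theorem integral_correctedSlope (hσt : σt ≠ 0) :
    ∫ p, correctedSlope M lam σt (phaseNoise lam σt p)
      ∂((gaussianReal 0 1).prod (ambiguityPrior M)) = hFactor M (lam / σt) := by
  have hb : ∀ k, Integrable (fun p => postMean M lam σt k (phaseNoise lam σt p))
      ((gaussianReal 0 1).prod (ambiguityPrior M)) := fun k =>
    integrable_phaseNoise_of_growth M lam σt (continuous_postMean M lam σt k) (C := (M : ℝ) ^ k)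
      fun x => (abs_postMean_le M lam σt k x).trans
        (le_mul_of_one_le_right (by positivity) (by nlinarith [sq_nonneg x]))
  have hb2 : Integrable (fun p => postMean M lam σt 1 (phaseNoise lam σt p) ^ 2)
      ((gaussianReal 0 1).prod (ambiguityPrior M)) := by
    refine integrable_phaseNoise_of_growth M lam σt (f := fun x => postMean M lam σt 1 x ^ 2)
      ((continuous_postMean M lam σt 1).pow 2) (C := (M : ℝ) ^ 2) fun x => ?_
    rw [abs_pow]
    have h1 := abs_postMean_le M lam σt 1 x
    rw [pow_one] at h1
    refine le_trans (by gcongr) (le_mul_of_one_le_right (by positivity) (by nlinarith [sq_nonneg x]))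
  have hd : Integrable (fun p => postMean M lam σt 2 (phaseNoise lam σt p) -
      postMean M lam σt 1 (phaseNoise lam σt p) ^ 2)
      ((gaussianReal 0 1).prod (ambiguityPrior M)) := (hb 2).sub hb2
  simp only [correctedSlope]
  rw [integral_sub (integrable_const _) (hd.const_mul _), integral_const_mul,
    hFactor]
  have hswap := integral_prod_swap (μ := gaussianReal 0 1) (ν := ambiguityPrior M)
    (fun p : ℝ × ℤ => postMean M lam σt 2 (lam * p.2 + σt * p.1) -
      postMean M lam σt 1 (lam * p.2 + σt * p.1) ^ 2)
  simp only [Prod.fst_swap, Prod.snd_swap] at hswap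
  simp only [posteriorMoment_eq M lam hσt, hswap]
  simp [phaseNoise]

/-- The information identity for the phase noise. -/
theorem integral_corrected_sq (hσt : σt ≠ 0) :
    ∫ p, corrected M lam σt (phaseNoise lam σt p) ^ 2
      ∂((gaussianReal 0 1).prod (ambiguityPrior M)) = σt ^ 2 * hFactor M (lam / σt) := by
  obtain ⟨C, hC⟩ := exists_growth_corrected M lam (σt := σt)
  rw [← integral_correctedSlope M lam hσt, ← integral_mul_corrected M lam hσt
    (hasDerivAt_corrected M lam σt) (continuous_correctedSlope M lam σt) (fun x => (hC x).1)
    (fun x => (hC x).2.2) (fun x => (hC x).2.1)]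
  simp only [sq]

/-- By the information identity `σ̃² h` is a second moment. Nonnegativity is enough to make `σ⁻² + h
σ̃⁻²` positive. -/
theorem hFactor_nonneg (hσt : σt ≠ 0) : 0 ≤ hFactor M (lam / σt) := by
  have h := integral_corrected_sq M lam hσt
  have h0 : 0 ≤ ∫ p, corrected M lam σt (phaseNoise lam σt p) ^ 2
      ∂((gaussianReal 0 1).prod (ambiguityPrior M)) := integral_nonneg fun p => sq_nonneg _
  rw [h] at h0
  exact nonneg_of_mul_nonneg_right h0 (by positivity)

end ObservationLaw

/-! ### Design vectors and their Gram form -/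

/-- The design row as a vector of the parameter space. -/
def designVec (u : Sph) : E4 := WithLp.toLp 2 (designRow u)

theorem continuous_designRow : Continuous designRow := by
  refine continuous_pi fun i => ?_
  fin_cases i <;> simp [designRow] <;> fun_prop

theorem continuous_designVec : Continuous designVec :=
  (PiLp.continuous_toLp 2 _).comp continuous_designRow

/-- The norm is exactly `√2`, as `u` is a unit vector; `2` is a convenient bound. -/
theorem norm_designVec_le (u : Sph) : ‖designVec u‖ ≤ 2 := by
  have hu : ‖(u : E3)‖ ^ 2 = 1 := by rw [norm_eq_of_mem_sphere, one_pow]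
  rw [EuclideanSpace.real_norm_sq_eq, Fin.sum_univ_three] at hu
  have h : ‖designVec u‖ ^ 2 = 2 := by
    rw [EuclideanSpace.real_norm_sq_eq, Fin.sum_univ_four]
    simp [designVec, designRow]
    linarith
  nlinarith [norm_nonneg (designVec u)]

theorem inner_designVec (u : Sph) (d : E4) :
    inner ℝ (designVec u) d = ∑ i, designRow u i * d i := by
  simp [designVec, PiLp.inner_apply, mul_comm]

theorem abs_inner_designVec_le (u : Sph) (d : E4) : |inner ℝ (designVec u) d| ≤ 2 * ‖d‖ :=
  (abs_real_inner_le_norm _ _).trans (by gcongr; exact norm_designVec_le u)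

theorem integral_inner_designVec_mul (d e : E4) :
    ∫ u, inner ℝ (designVec u) d * inner ℝ (designVec u) e ∂hemisphereUniform =
      inner ℝ d (toEuclideanCLM (𝕜 := ℝ) gramMean e) := by
  have hint : ∀ i j, Integrable (fun u => designRow u i * designRow u j) hemisphereUniform := by
    intro i j
    have hc : ∀ i, Continuous fun u => designRow u i := fun i =>
      (continuous_apply i).comp continuous_designRow
    exact ((hc i).mul (hc j)).integrable_of_hasCompactSupport
      (HasCompactSupport.of_compactSpace _)
  have h : ∀ u, inner ℝ (designVec u) d * inner ℝ (designVec u) e =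
      ∑ i, ∑ j, d i * e j * (designRow u i * designRow u j) := by
    intro u
    rw [inner_designVec, inner_designVec, Finset.sum_mul_sum]
    refine Finset.sum_congr rfl fun i _ => Finset.sum_congr rfl fun j _ => ?_
    ring
  simp only [h]
  rw [integral_finsetSum _ fun i _ => integrable_finsetSum _ fun j _ => (hint i j).const_mul _]
  rw [inner_toEuclideanCLM, dotProduct]
  refine Finset.sum_congr rfl fun i _ => ?_
  rw [integral_finsetSum _ fun j _ => (hint i j).const_mul _, mulVec, dotProduct, Finset.mul_sum]
  refine Finset.sum_congr rfl fun j _ => ?_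
  rw [integral_const_mul, integral_designRow_mul]
  ring

/-! ### The score of one satellite: linearization, mean and covariance -/

section Score

/-- The data of one satellite. -/
abbrev Datum : Type := Sph × ℝ × ℝ × ℤ

/-- The law of the noise variables `(z, z̃, m)` of one satellite. -/
abbrev noiseLaw (M : ℕ) : Measure (ℝ × ℝ × ℤ) :=
  (gaussianReal 0 1).prod ((gaussianReal 0 1).prod (ambiguityPrior M))

theorem satelliteLaw_eq (M : ℕ) : satelliteLaw M = hemisphereUniform.prod (noiseLaw M) := rfl

instance (M : ℕ) : IsProbabilityMeasure (satelliteLaw M) := by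
  rw [satelliteLaw_eq]
  infer_instance

variable (M : ℕ) (lam σ σt p q : ℝ)

/-- The combined scalar noise of one satellite. -/
def scalarNoise (y : ℝ × ℝ × ℤ) : ℝ :=
  p * (σ * y.1) + q * corrected M lam σt (phaseNoise lam σt y.2)

/-- The summand of the likelihood equation at the parameter error `d`. -/
def score (x : Datum) (d : E4) : E4 :=
  (p * (σ * x.2.1 - inner ℝ (designVec x.1) d) +
    q * corrected M lam σt (phaseNoise lam σt x.2.2 - inner ℝ (designVec x.1) d)) • designVec x.1

/-- The scalar weight of one satellite in the observed information. -/
def slopeWeight (y : ℝ × ℝ × ℤ) : ℝ :=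
  p + q * correctedSlope M lam σt (phaseNoise lam σt y.2)

/-- The contribution of one satellite to the observed information. -/
def information (x : Datum) : E4 →L[ℝ] E4 :=
  slopeWeight M lam σt p q x.2 •
    InnerProductSpace.rankOne ℝ (designVec x.1) (designVec x.1)

theorem score_zero (x : Datum) :
    score M lam σ σt p q x 0 = scalarNoise M lam σ σt p q x.2 • designVec x.1 := by
  simp [score, scalarNoise]

/-- The pseudo-range part is linear in `d` and cancels exactly, leaving the linearization error of
`corrected`. The factor 8 collects three uses of the bound `2` on the design vector. -/
theorem exists_score_approx (hq : 0 ≤ q) : ∃ K, 0 ≤ K ∧ ∀ x d d',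
    ‖score M lam σ σt p q x d - score M lam σ σt p q x d' +
      information M lam σt p q x (d - d')‖ ≤ K * max ‖d‖ ‖d'‖ * ‖d - d'‖ := by
  obtain ⟨C, hC, happ⟩ := exists_corrected_approx M lam σt
  refine ⟨q * C * 8, by positivity, fun x d d' => ?_⟩
  have h := happ (phaseNoise lam σt x.2.2) (inner ℝ (designVec x.1) d) (inner ℝ (designVec x.1) d')
  have heq : score M lam σ σt p q x d - score M lam σ σt p q x d' +
      information M lam σt p q x (d - d') =
      (q * (corrected M lam σt (phaseNoise lam σt x.2.2 - inner ℝ (designVec x.1) d) -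
        corrected M lam σt (phaseNoise lam σt x.2.2 - inner ℝ (designVec x.1) d') +
        correctedSlope M lam σt (phaseNoise lam σt x.2.2) *
          (inner ℝ (designVec x.1) d - inner ℝ (designVec x.1) d'))) • designVec x.1 := by
    simp only [score, information, slopeWeight, _root_.smul_apply,
      InnerProductSpace.rankOne_apply, inner_sub_right]
    module
  have h1 := abs_inner_designVec_le x.1 d
  have h2 := abs_inner_designVec_le x.1 d'
  have h3 := abs_inner_designVec_le x.1 (d - d')
  rw [inner_sub_right] at h3
  rw [heq, norm_smul, Real.norm_eq_abs, abs_mul, abs_of_nonneg hq]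
  have hmax : max |inner ℝ (designVec x.1) d| |inner ℝ (designVec x.1) d'| ≤
      2 * max ‖d‖ ‖d'‖ := by
    refine max_le (h1.trans ?_) (h2.trans ?_)
    · gcongr; exact le_max_left _ _
    · gcongr; exact le_max_right _ _
  calc _ ≤ q * (C * (2 * max ‖d‖ ‖d'‖) * (2 * ‖d - d'‖)) * 2 := by
        gcongr
        · exact h.trans (by gcongr)
        · exact norm_designVec_le _
    _ = _ := by ring

theorem measurable_scalarNoise : Measurable (scalarNoise M lam σ σt p q) :=
  ((measurable_fst.const_mul _).const_mul _).add
    (((continuous_corrected M lam σt).measurable.comp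
      ((measurable_phaseNoise lam σt).comp measurable_snd)).const_mul _)

theorem measurable_slopeWeight : Measurable (slopeWeight M lam σt p q) :=
  measurable_const.add (((continuous_correctedSlope M lam σt).measurable.comp
    ((measurable_phaseNoise lam σt).comp measurable_snd)).const_mul _)

theorem measurable_designVec_fst : Measurable fun x : Datum => designVec x.1 :=
  continuous_designVec.measurable.comp measurable_fst

theorem measurable_score_zero : Measurable fun x => score M lam σ σt p q x 0 := by
  simp only [score_zero]
  exact ((measurable_scalarNoise M lam σ σt p q).comp measurable_snd).smul measurable_designVec_fst

theorem continuous_rankOne_designVec :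
    Continuous fun u => InnerProductSpace.rankOne ℝ (designVec u) (designVec u) :=
  ((ContinuousLinearMap.smulRightL ℝ E4 E4).continuous.comp
    ((innerSL ℝ).continuous.comp continuous_designVec)).clm_apply continuous_designVec

theorem measurable_information : Measurable (information M lam σt p q) :=
  ((measurable_slopeWeight M lam σt p q).comp measurable_snd).smul
    (continuous_rankOne_designVec.measurable.comp measurable_fst)

theorem norm_rankOne_designVec_le (u : Sph) :
    ‖InnerProductSpace.rankOne ℝ (designVec u) (designVec u)‖ ≤ 4 := by
  rw [InnerProductSpace.norm_rankOne]
  nlinarith [norm_designVec_le u, norm_nonneg (designVec u)]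

theorem integrable_rankOne_designVec : Integrable
    (fun x : Datum => InnerProductSpace.rankOne ℝ (designVec x.1) (designVec x.1))
    (satelliteLaw M) :=
  (integrable_const (4 : ℝ)).mono'
    (continuous_rankOne_designVec.measurable.comp measurable_fst).aestronglyMeasurable
    (ae_of_all _ fun x => norm_rankOne_designVec_le x.1)

theorem integrable_information : Integrable (information M lam σt p q) (satelliteLaw M) := by
  obtain ⟨C, hC, hs⟩ := exists_abs_correctedSlope_le M lam σt
  refine (integrable_const ((|p| + |q| * C) * 4)).mono'
    (measurable_information M lam σt p q).aestronglyMeasurable (ae_of_all _ fun x => ?_)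
  rw [information, norm_smul]
  refine mul_le_mul ?_ (norm_rankOne_designVec_le _) (norm_nonneg _) (by positivity)
  refine (norm_add_le _ _).trans ?_
  rw [norm_mul]
  simp only [Real.norm_eq_abs]
  gcongr
  exact hs _

theorem inner_integral_apply {X : Type*} [MeasurableSpace X] {μ : Measure X}
    {A : X → E4 →L[ℝ] E4} (hA : Integrable A μ) (d e : E4) :
    inner ℝ e ((∫ x, A x ∂μ) d) = ∫ x, inner ℝ e (A x d) ∂μ := by
  rw [ContinuousLinearMap.integral_apply hA,
    integral_inner (𝕜 := ℝ) (hA.apply_continuousLinearMap d)]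

/-- Direction and noise are independent; tested against two vectors, the integral factors into the
mean of `f` and the Gram form. -/
theorem integral_smul_rankOne {f : ℝ × ℝ × ℤ → ℝ} (hf : Integrable (fun x : Datum => f x.2 •
    InnerProductSpace.rankOne ℝ (designVec x.1) (designVec x.1)) (satelliteLaw M)) :
    ∫ x : Datum, f x.2 • InnerProductSpace.rankOne ℝ (designVec x.1) (designVec x.1)
      ∂(satelliteLaw M) = (∫ y, f y ∂(noiseLaw M)) • toEuclideanCLM (𝕜 := ℝ) gramMean := by
  ext1 d
  refine ext_inner_left ℝ fun e => ?_
  rw [inner_integral_apply hf]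
  simp only [_root_.smul_apply, InnerProductSpace.rankOne_apply, inner_smul_right]
  rw [← integral_inner_designVec_mul, mul_comm, ← integral_prod_mul, ← satelliteLaw_eq]
  refine integral_congr_ae (ae_of_all _ fun x => ?_)
  simp only [real_inner_comm]
  ring

theorem integral_rankOne_designVec :
    ∫ x : Datum, InnerProductSpace.rankOne ℝ (designVec x.1) (designVec x.1) ∂(satelliteLaw M) =
      toEuclideanCLM (𝕜 := ℝ) gramMean := by
  have h := integral_smul_rankOne M (f := fun _ => 1) (by
    simpa using integrable_rankOne_designVec M)
  simpa using h

variable {σt}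

theorem integral_slopeWeight (hσt : σt ≠ 0) :
    ∫ y, slopeWeight M lam σt p q y ∂(noiseLaw M) = p + q * hFactor M (lam / σt) := by
  obtain ⟨C, hC⟩ := exists_growth_corrected M lam (σt := σt)
  have hint := integrable_phaseNoise_of_growth M lam σt (continuous_correctedSlope M lam σt)
    fun x => (hC x).2.2
  simp only [slopeWeight]
  rw [integral_fun_snd (fun y : ℝ × ℤ => p + q * correctedSlope M lam σt (phaseNoise lam σt y)),
    integral_add (integrable_const _) (hint.const_mul _), integral_const_mul,
    integral_correctedSlope M lam hσt]
  simp

theorem integral_information (hσt : σt ≠ 0) : ∫ x, information M lam σt p q x ∂(satelliteLaw M) =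
    (p + q * hFactor M (lam / σt)) • toEuclideanCLM (𝕜 := ℝ) gramMean := by
  rw [← integral_slopeWeight M lam p q hσt]
  exact integral_smul_rankOne M (integrable_information M lam σt p q)

theorem integral_id_gaussianReal_zero : ∫ z, z ∂(gaussianReal 0 1) = 0 := by simp

theorem integral_sq_gaussianReal : ∫ z, z ^ 2 ∂(gaussianReal 0 1) = 1 := by
  have h := variance_of_integral_eq_zero (X := fun z : ℝ => z) (μ := gaussianReal 0 1)
    aemeasurable_id integral_id_gaussianReal_zero
  rw [variance_fun_id_gaussianReal] at h
  simpa using h.symm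

theorem integrable_id_gaussianReal_zero : Integrable (fun z : ℝ => z) (gaussianReal 0 1) :=
  (memLp_id_gaussianReal 1).integrable (by simp)

theorem integrable_sq_gaussianReal_zero : Integrable (fun z : ℝ => z ^ 2) (gaussianReal 0 1) :=
  (memLp_id_gaussianReal 2).integrable_sq

theorem integral_scalarNoise (hσt : σt ≠ 0) :
    ∫ y, scalarNoise M lam σ σt p q y ∂(noiseLaw M) = 0 := by
  have h1 := integrable_id_gaussianReal_zero.comp_fst
    ((gaussianReal 0 1).prod (ambiguityPrior M))
  have h2 := (integrable_corrected M lam (σt := σt)).comp_snd (gaussianReal 0 1)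
  simp only [scalarNoise]
  rw [integral_add ((h1.const_mul _).const_mul _) (h2.const_mul _), integral_const_mul,
    integral_const_mul, integral_const_mul, integral_fun_fst (fun z : ℝ => z),
    integral_fun_snd (fun y => corrected M lam σt (phaseNoise lam σt y)),
    integral_corrected M lam hσt, integral_id_gaussianReal_zero]
  simp

theorem scalarNoise_sq (y : ℝ × ℝ × ℤ) : scalarNoise M lam σ σt p q y ^ 2 =
    p ^ 2 * σ ^ 2 * y.1 ^ 2 + (2 * p * q * σ * (y.1 * corrected M lam σt (phaseNoise lam σt y.2)) +
      q ^ 2 * corrected M lam σt (phaseNoise lam σt y.2) ^ 2) := by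
  rw [scalarNoise]
  ring

theorem integrable_scalarNoise_sq :
    Integrable (fun y => scalarNoise M lam σ σt p q y ^ 2) (noiseLaw M) := by
  simp only [scalarNoise_sq]
  exact ((integrable_sq_gaussianReal_zero.comp_fst _).const_mul _).add
    (((integrable_id_gaussianReal_zero.mul_prod (integrable_corrected M lam)).const_mul _).add
      (((integrable_corrected_sq M lam).comp_snd _).const_mul _))

/-- The cross term vanishes because `z` is centred and independent of the phase noise; the last term
is the information identity. -/
theorem integral_scalarNoise_sq (hσt : σt ≠ 0) :
    ∫ y, scalarNoise M lam σ σt p q y ^ 2 ∂(noiseLaw M) =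
      p ^ 2 * σ ^ 2 + q ^ 2 * (σt ^ 2 * hFactor M (lam / σt)) := by
  have h1 := integrable_sq_gaussianReal_zero.comp_fst
    ((gaussianReal 0 1).prod (ambiguityPrior M))
  have h2 := (integrable_corrected_sq M lam (σt := σt)).comp_snd (gaussianReal 0 1)
  have h3 := integrable_id_gaussianReal_zero.mul_prod (integrable_corrected M lam (σt := σt))
  have h23 : Integrable (fun y : ℝ × ℝ × ℤ =>
      2 * p * q * σ * (y.1 * corrected M lam σt (phaseNoise lam σt y.2)) +
        q ^ 2 * corrected M lam σt (phaseNoise lam σt y.2) ^ 2) (noiseLaw M) :=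
    (h3.const_mul _).add (h2.const_mul _)
  simp only [scalarNoise_sq]
  rw [integral_add (h1.const_mul _) h23,
    integral_add (h3.const_mul _) (h2.const_mul _), integral_const_mul,
    integral_const_mul, integral_const_mul, integral_fun_fst (fun z : ℝ => z ^ 2),
    integral_fun_snd (fun y => corrected M lam σt (phaseNoise lam σt y) ^ 2),
    integral_prod_mul (fun z : ℝ => z) (fun y => corrected M lam σt (phaseNoise lam σt y)),
    integral_corrected_sq M lam hσt, integral_id_gaussianReal_zero, integral_sq_gaussianReal]
  simp

theorem memLp_smul_designVec {f : ℝ × ℝ × ℤ → ℝ} (hf : Measurable f)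
    (hf2 : Integrable (fun y => f y ^ 2) (noiseLaw M)) :
    MemLp (fun x : Datum => f x.2 • designVec x.1) 2 (satelliteLaw M) := by
  have h1 : MemLp (fun x : Datum => f x.2) 2 (satelliteLaw M) :=
    ((memLp_two_iff_integrable_sq hf.aestronglyMeasurable).2 hf2).comp_snd hemisphereUniform
  refine (h1.const_mul 2).of_le ((hf.comp measurable_snd).smul
    measurable_designVec_fst).aestronglyMeasurable (ae_of_all _ fun x => ?_)
  rw [norm_smul, norm_mul, mul_comm, Real.norm_two]
  gcongr
  exact norm_designVec_le _

theorem integral_smul_designVec {f : ℝ × ℝ × ℤ → ℝ} (hf0 : ∫ y, f y ∂(noiseLaw M) = 0) :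
    ∫ x : Datum, f x.2 • designVec x.1 ∂(satelliteLaw M) = 0 := by
  have h := integral_prod_smul (μ := noiseLaw M) (ν := hemisphereUniform) f designVec
  rw [hf0, zero_smul, ← integral_prod_swap] at h
  exact h

theorem integral_inner_smul_sq (f : ℝ × ℝ × ℤ → ℝ) (t : E4) :
    ∫ x : Datum, (inner ℝ t (f x.2 • designVec x.1)) ^ 2 ∂(satelliteLaw M) =
      (∫ y, f y ^ 2 ∂(noiseLaw M)) * inner ℝ t (toEuclideanCLM (𝕜 := ℝ) gramMean t) := by
  rw [← integral_inner_designVec_mul, mul_comm, ← integral_prod_mul, ← satelliteLaw_eq]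
  refine integral_congr_ae (ae_of_all _ fun x => ?_)
  simp only [inner_smul_right, real_inner_comm]
  ring

end Score

/-! ### From the likelihood equation to a zero of the summed scores -/

section NormalEquations

variable {S : ℕ} (u : Fin S → Sph)

theorem designMatrix_mulVec (v : E4) (s : Fin S) :
    (designMatrix u *ᵥ v.ofLp) s = inner ℝ (designVec (u s)) v := by
  rw [inner_designVec]
  rfl

theorem toLp_transpose_mulVec (r : Fin S → ℝ) :
    WithLp.toLp 2 ((designMatrix u)ᵀ *ᵥ r) = ∑ s, r s • designVec (u s) := by
  ext i
  simp [mulVec, dotProduct, designMatrix, designVec, mul_comm]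

theorem toLp_gram_mulVec (v : E4) :
    WithLp.toLp 2 (((designMatrix u)ᵀ * designMatrix u) *ᵥ v.ofLp) =
      ∑ s, inner ℝ (designVec (u s)) v • designVec (u s) := by
  rw [← mulVec_mulVec, toLp_transpose_mulVec]
  simp only [designMatrix_mulVec]

variable {u} in
/-- The normal equations for the least-squares map. -/
theorem eq_leastSquares_iff (hdet : IsUnit ((designMatrix u)ᵀ * designMatrix u).det)
    (r : Fin S → ℝ) (v : E4) : v = leastSquares (designMatrix u) r ↔
      ∑ s, (r s - inner ℝ (designVec (u s)) v) • designVec (u s) = 0 := by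
  set A := (designMatrix u)ᵀ * designMatrix u with hA
  have h1 : v = leastSquares (designMatrix u) r ↔
      A *ᵥ v.ofLp = (designMatrix u)ᵀ *ᵥ r := by
    rw [leastSquares, ← hA]
    constructor
    · intro h
      rw [h]
      simp only [mulVec_mulVec, mul_nonsing_inv_cancel_left _ _ hdet]
    · intro h
      rw [← h, mulVec_mulVec, nonsing_inv_mul _ hdet, one_mulVec]
  rw [h1, ← (WithLp.toLp_injective 2).eq_iff, toLp_gram_mulVec, toLp_transpose_mulVec, eq_comm,
    ← sub_eq_zero, ← Finset.sum_sub_distrib]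
  simp only [sub_smul]

variable {u} in
-- The two weights sum to one, so the fitted value can be split between the two measurements. In
-- each residual `w` cancels and only the noise and `d` remain.
theorem isLikelihoodRoot_iff (M : ℕ) {lam σ σt : ℝ} (hσ : 0 < σ) (w d : E4)
    (hdet : IsUnit ((designMatrix u)ᵀ * designMatrix u).det)
    (z zt : Fin S → ℝ) (m : Fin S → ℤ) :
    IsLikelihoodRoot M lam σ σt (designMatrix u) (pseudoRange σ w u z)
      (carrierPhase lam σt w u m zt) (w + d) ↔
    ∑ s, score M lam σ σt (σ⁻¹ ^ 2 / (σ⁻¹ ^ 2 + σt⁻¹ ^ 2)) (σt⁻¹ ^ 2 / (σ⁻¹ ^ 2 + σt⁻¹ ^ 2))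
      (u s, z s, zt s, m s) d = 0 := by
  rw [IsLikelihoodRoot, eq_leastSquares_iff hdet]
  refine Eq.congr (Finset.sum_congr rfl fun s _ => ?_) rfl
  have hD : 0 < σ⁻¹ ^ 2 + σt⁻¹ ^ 2 := by positivity
  have hpq : σ⁻¹ ^ 2 / (σ⁻¹ ^ 2 + σt⁻¹ ^ 2) = 1 - σt⁻¹ ^ 2 / (σ⁻¹ ^ 2 + σt⁻¹ ^ 2) := by
    field_simp
    ring
  rw [score, hpq]
  set q := σt⁻¹ ^ 2 / (σ⁻¹ ^ 2 + σt⁻¹ ^ 2)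
  congr 1
  have hres : carrierPhase lam σt w u m zt s - (designMatrix u *ᵥ (w + d).ofLp) s =
      phaseNoise lam σt (zt s, m s) - inner ℝ (designVec (u s)) d := by
    rw [designMatrix_mulVec, inner_add_right]
    simp only [carrierPhase, phaseNoise, Pi.add_apply, designMatrix_mulVec, Pi.smul_apply,
      smul_eq_mul]
    ring
  have hy : pseudoRange σ w u z s = inner ℝ (designVec (u s)) w + σ * z s := by
    simp [pseudoRange, designMatrix_mulVec]
  have hyt : carrierPhase lam σt w u m zt s =
      inner ℝ (designVec (u s)) w + phaseNoise lam σt (zt s, m s) := by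
    simp only [carrierPhase, phaseNoise, Pi.add_apply, designMatrix_mulVec, Pi.smul_apply,
      smul_eq_mul]
    ring
  simp only [Pi.add_apply, Pi.smul_apply, Pi.sub_apply, smul_eq_mul, ambiguityMMSE_eq]
  rw [hres, hy, hyt, inner_add_right, corrected]
  ring

end NormalEquations

/-! ### Consistency of the pseudo-range only estimator -/

section Pilot

theorem toEuclideanCLM_Qmat_mul_gramMean :
    (toEuclideanCLM (𝕜 := ℝ) Qmat).comp (toEuclideanCLM (𝕜 := ℝ) gramMean) =
      ContinuousLinearMap.id ℝ E4 := by
  rw [← ContinuousLinearMap.mul_def, ← map_mul, Qmat_mul_gramMean, map_one]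
  rfl

theorem toEuclideanCLM_gramMean_mul_Qmat :
    (toEuclideanCLM (𝕜 := ℝ) gramMean).comp (toEuclideanCLM (𝕜 := ℝ) Qmat) =
      ContinuousLinearMap.id ℝ E4 := by
  rw [← ContinuousLinearMap.mul_def, ← map_mul, gramMean_mul_Qmat, map_one]
  rfl

/-- Along a sequence of directions whose empirical Gram matrices converge to `gramMean`, the design
is eventually nonsingular and the pseudo-range only estimator is consistent. -/
theorem pilot_consistent {σ : ℝ} {w : E4} {u : ℕ → Sph} {z : ℕ → ℝ}
    (hB : Tendsto (fun n : ℕ => (n : ℝ)⁻¹ • ∑ s ∈ Finset.range n,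
      InnerProductSpace.rankOne ℝ (designVec (u s)) (designVec (u s))) atTop
      (𝓝 (toEuclideanCLM (𝕜 := ℝ) gramMean)))
    (he : Tendsto (fun n : ℕ => (n : ℝ)⁻¹ • ∑ s ∈ Finset.range n,
      (σ * z s) • designVec (u s)) atTop (𝓝 0)) :
    (∀ᶠ n : ℕ in atTop, IsUnit ((designMatrix fun s : Fin n => u s)ᵀ *
      designMatrix fun s : Fin n => u s).det) ∧
    Tendsto (fun n : ℕ => leastSquares (designMatrix fun s : Fin n => u s)
      (pseudoRange σ w (fun s : Fin n => u s) fun s : Fin n => z s) - w) atTop (𝓝 0) := by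
  set L := toEuclideanCLM (𝕜 := ℝ) Qmat
  set B : ℕ → E4 →L[ℝ] E4 := fun n => (n : ℝ)⁻¹ • ∑ s ∈ Finset.range n,
      InnerProductSpace.rankOne ℝ (designVec (u s)) (designVec (u s)) with hBdef
  set e : ℕ → E4 := fun n => (n : ℝ)⁻¹ • ∑ s ∈ Finset.range n, (σ * z s) • designVec (u s) with hedef
  have hLB : Tendsto (fun n => ‖L.comp (B n) - ContinuousLinearMap.id ℝ E4‖) atTop (𝓝 0) := by
    have h1 : Tendsto (fun n => L.comp (B n)) atTop (𝓝 (L.comp (toEuclideanCLM (𝕜 := ℝ) gramMean))) :=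
      ((ContinuousLinearMap.compL ℝ E4 E4 E4 L).continuous.tendsto _).comp hB
    rw [toEuclideanCLM_Qmat_mul_gramMean] at h1
    exact tendsto_iff_norm_sub_tendsto_zero.1 h1
  have hBapp : ∀ n x, B n x = (n : ℝ)⁻¹ • ∑ s : Fin n,
      inner ℝ (designVec (u s)) x • designVec (u s) := by
    intro n x
    simp only [hBdef, _root_.smul_apply, _root_.sum_apply, InnerProductSpace.rankOne_apply,
      Finset.sum_range]
  -- As soon as `L ∘ B n` is within `1/2` of the identity, it is bounded below. This yields both the
  -- invertibility of the Gram matrix and the error bound.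
  have hnorm : ∀ᶠ n in atTop, ∀ x, ‖x‖ ≤ 2 * ‖L (B n x)‖ := by
    filter_upwards [hLB.eventually_le_const (show (0 : ℝ) < 1 / 2 by norm_num)] with n hn x
    have h1 := (L.comp (B n) - ContinuousLinearMap.id ℝ E4).le_of_opNorm_le hn x
    simp only [_root_.sub_apply, ContinuousLinearMap.comp_apply, ContinuousLinearMap.id_apply] at h1
    have h2 := norm_sub_norm_le x (L (B n x))
    rw [norm_sub_rev] at h2
    linarith
  have hdet : ∀ᶠ n : ℕ in atTop, IsUnit ((designMatrix fun s : Fin n => u s)ᵀ *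
      designMatrix fun s : Fin n => u s).det := by
    filter_upwards [hnorm] with n hn
    rw [← isUnit_iff_isUnit_det, ← mulVec_injective_iff_isUnit, ← coe_mulVecLin,
      injective_iff_map_eq_zero]
    intro x hx
    have h1 := toLp_gram_mulVec (fun s : Fin n => u s) (WithLp.toLp 2 x)
    rw [mulVecLin_apply] at hx
    simp only [hx] at h1
    have h2 := hn (WithLp.toLp 2 x)
    rw [hBapp, ← h1] at h2
    simpa using h2
  refine ⟨hdet, ?_⟩
  have hbound : ∀ᶠ n : ℕ in atTop, ‖leastSquares (designMatrix fun s : Fin n => u s)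
      (pseudoRange σ w (fun s : Fin n => u s) fun s : Fin n => z s) - w‖ ≤ 2 * (‖L‖ * ‖e n‖) := by
    filter_upwards [hdet, hnorm] with n h1 h2
    have h3 := (eq_leastSquares_iff h1 (pseudoRange σ w (fun s : Fin n => u s)
      fun s : Fin n => z s) _).1 rfl
    set v := leastSquares (designMatrix fun s : Fin n => u s)
      (pseudoRange σ w (fun s : Fin n => u s) fun s : Fin n => z s)
    -- The normal equations with the contribution of `w` removed: the pilot error solves the Gram
    -- system with the averaged noise on the right.
    have h4 : B n (v - w) = e n := by
      rw [hBapp, hedef]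
      simp only [Finset.sum_range]
      congr 1
      rw [eq_comm, ← sub_eq_zero, ← Finset.sum_sub_distrib, ← h3]
      refine Finset.sum_congr rfl fun s _ => ?_
      rw [← sub_smul, inner_sub_right]
      congr 1
      simp only [pseudoRange, Pi.add_apply, designMatrix_mulVec, Pi.smul_apply, smul_eq_mul]
      ring
    refine (h2 _).trans ?_
    rw [h4]
    gcongr
    exact L.le_opNorm _
  refine squeeze_zero_norm' hbound ?_
  simpa using (he.norm.const_mul ‖L‖).const_mul 2

end Pilot

/-! ### Symmetry and positivity of the limiting covariance -/

section Covariance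

theorem Qmat_isHermitian : Qmat.IsHermitian := by
  ext i j
  fin_cases i <;> fin_cases j <;> simp [Qmat]

theorem smul_Qmat_posSemidef {c : ℝ} (hc : 0 ≤ c) : (c • Qmat).PosSemidef := by
  refine PosSemidef.smul ?_ hc
  refine .of_dotProduct_mulVec_nonneg Qmat_isHermitian fun x => ?_
  have h : star x ⬝ᵥ (Qmat *ᵥ x) =
      3 * x 0 ^ 2 + 3 * x 1 ^ 2 + 3 * (2 * x 2 + x 3) ^ 2 + x 3 ^ 2 := by
    simp only [Qmat, dotProduct, mulVec, Fin.sum_univ_four]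
    simp
    ring
  rw [h]
  positivity

theorem inner_toEuclideanCLM_Qmat (x y : E4) :
    inner ℝ x (toEuclideanCLM (𝕜 := ℝ) Qmat y) = inner ℝ (toEuclideanCLM (𝕜 := ℝ) Qmat x) y := by
  rw [← ContinuousLinearMap.adjoint_inner_left, ← ContinuousLinearMap.star_eq_adjoint, ← map_star,
    star_eq_conjTranspose, Qmat_isHermitian.eq]

end Covariance

end GNSS

end

/-! ### The main theorem -/

theorem theorem2
    {Ω : Type*} [MeasurableSpace Ω] (P : Measure Ω) [IsProbabilityMeasure P]
    (M : ℕ) (hM : 0 < M)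
    (lam σ σt : ℝ) (hlam : 0 < lam) (hσ : 0 < σ) (hσt : 0 < σt)
    (w : GNSS.E4)
    (u : ℕ → Ω → GNSS.Sph) (z zt : ℕ → Ω → ℝ) (m : ℕ → Ω → ℤ)
    (hlaw : ∀ s, HasLaw (fun ω => (u s ω, z s ω, zt s ω, m s ω)) (GNSS.satelliteLaw M) P)
    (hindep : iIndepFun (fun s ω => (u s ω, z s ω, zt s ω, m s ω)) P)
    (what : ℕ → Ω → GNSS.E4)
    (hmeas : ∀ S, AEMeasurable (what S) P)
    (hwhat : ∀ S : ℕ, ∀ᵐ ω ∂P,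
      let G : Matrix (Fin S) (Fin 4) ℝ := GNSS.designMatrix (fun s : Fin S => u s ω)
      IsUnit (Gᵀ * G).det →
        GNSS.IsClosestLikelihoodRoot M lam σ σt G
          (GNSS.pseudoRange σ w (fun s : Fin S => u s ω) (fun s : Fin S => z s ω))
          (GNSS.carrierPhase lam σt w (fun s : Fin S => u s ω) (fun s : Fin S => m s ω)
            (fun s : Fin S => zt s ω))
          (what S ω)) :
    TendstoInMeasure P what atTop (fun _ => w) ∧
    TendstoInDistribution (fun (S : ℕ) ω => Real.sqrt (S : ℝ) • (what S ω - w)) atTop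
      (id : GNSS.E4 → GNSS.E4) (fun _ => P)
      (multivariateGaussian 0
        ((1 / (σ⁻¹ ^ 2 + GNSS.hFactor M (lam / σt) * σt⁻¹ ^ 2)) • GNSS.Qmat)) := by
  have hσt0 := hσt.ne'
  have hh : 0 ≤ GNSS.hFactor M (lam / σt) := GNSS.hFactor_nonneg M lam hσt0
  set h := GNSS.hFactor M (lam / σt) with hdef
  have hJ : 0 < σ⁻¹ ^ 2 + h * σt⁻¹ ^ 2 := by positivity
  have hD : 0 < σ⁻¹ ^ 2 + σt⁻¹ ^ 2 := by positivity
  let p := σ⁻¹ ^ 2 / (σ⁻¹ ^ 2 + σt⁻¹ ^ 2)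
  let q := σt⁻¹ ^ 2 / (σ⁻¹ ^ 2 + σt⁻¹ ^ 2)
  have hq : 0 ≤ q := by positivity
  have hκ : p + q * h = (σ⁻¹ ^ 2 + h * σt⁻¹ ^ 2) / (σ⁻¹ ^ 2 + σt⁻¹ ^ 2) := by
    simp only [p, q]
    ring
  have hκ0 : 0 < p + q * h := by rw [hκ]; positivity
  -- The score variance has the same numerator as `p + q h`, so dividing by `(p + q h)²` leaves `1 /
  -- (σ⁻² + h σ̃⁻²)`.
  have hV : p ^ 2 * σ ^ 2 + q ^ 2 * (σt ^ 2 * h) =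
      (σ⁻¹ ^ 2 + h * σt⁻¹ ^ 2) / (σ⁻¹ ^ 2 + σt⁻¹ ^ 2) ^ 2 := by
    simp only [p, q]
    field_simp
  let L := toEuclideanCLM (𝕜 := ℝ) GNSS.Qmat
  -- `T` is the inverse of the mean information `(p + q h) • gramMean`; it normalizes the score, and
  -- being injective it does not change the roots.
  let T : GNSS.E4 →L[ℝ] GNSS.E4 := (p + q * h)⁻¹ • L
  have hTinj : ∀ x, T x = 0 → x = 0 := by
    intro x hx
    have h1 : L x = 0 := by
      simpa [T, hκ0.ne'] using hx
    have h2 := congrArg (fun A : GNSS.E4 →L[ℝ] GNSS.E4 => A x)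
      GNSS.toEuclideanCLM_gramMean_mul_Qmat
    simp only [ContinuousLinearMap.comp_apply, ContinuousLinearMap.id_apply] at h2
    rw [← h2]
    change toEuclideanCLM (𝕜 := ℝ) GNSS.gramMean (L x) = 0
    rw [h1, map_zero]
  obtain ⟨K, hK, happ⟩ := GNSS.exists_score_approx M lam σ σt p q hq
  have hscore2 : MemLp (fun x => GNSS.score M lam σ σt p q x 0) 2 (GNSS.satelliteLaw M) := by
    simp only [GNSS.score_zero]
    exact GNSS.memLp_smul_designVec M (GNSS.measurable_scalarNoise M lam σ σt p q)
      (GNSS.integrable_scalarNoise_sq M lam σ p q)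
  have hinfo := GNSS.integrable_information M lam σt p q
  have hrank := GNSS.strong_law_of_hasLaw hlaw hindep
    (GNSS.continuous_rankOne_designVec.measurable.comp measurable_fst)
    (GNSS.integrable_rankOne_designVec M)
  have hz := GNSS.strong_law_of_hasLaw hlaw hindep
    (f := fun x : GNSS.Datum => (σ * x.2.1) • GNSS.designVec x.1)
    ((measurable_fst.comp measurable_snd).const_mul σ |>.smul GNSS.measurable_designVec_fst)
    ((GNSS.memLp_smul_designVec M (f := fun y => σ * y.1) (measurable_fst.const_mul σ) (by
      simp only [mul_pow]
      exact (GNSS.integrable_sq_gaussianReal_zero.comp_fst _).const_mul _)).integrable one_le_two)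
  rw [GNSS.integral_smul_designVec M (f := fun y => σ * y.1) (by
    rw [integral_const_mul, integral_fun_fst (fun z : ℝ => z)]
    simp)] at hz
  rw [show ∫ x : GNSS.Datum, ((fun u => InnerProductSpace.rankOne ℝ (GNSS.designVec u)
    (GNSS.designVec u)) ∘ Prod.fst) x ∂(GNSS.satelliteLaw M) = _ from
      GNSS.integral_rankOne_designVec M] at hrank
  have hpilot := hrank.mp (hz.mono fun ω h2 h1 =>
    GNSS.pilot_consistent (w := w) (σ := σ) (u := fun s => u s ω) (z := fun s => z s ω) h1 h2)
  have key := GNSS.closest_zero_limit hlaw hindep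
    (Ψ := fun x d => T (GNSS.score M lam σ σt p q x d))
    (A := fun x => T.comp (GNSS.information M lam σt p q x)) (K := ‖T‖ * K) (by positivity)
    ((ContinuousLinearMap.compL ℝ GNSS.E4 GNSS.E4 GNSS.E4 T).continuous.measurable.comp
      (GNSS.measurable_information M lam σt p q))
    ((ContinuousLinearMap.compL ℝ GNSS.E4 GNSS.E4 GNSS.E4 T).integrable_comp hinfo)
    (by
      have h1 := (ContinuousLinearMap.compL ℝ GNSS.E4 GNSS.E4 GNSS.E4 T).integral_comp_comm hinfo
      simp only [ContinuousLinearMap.compL_apply] at h1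
      rw [h1, GNSS.integral_information M lam p q hσt0, ← hdef]
      simp only [T, ContinuousLinearMap.comp_smul, ContinuousLinearMap.smul_comp, smul_smul]
      rw [mul_inv_cancel₀ hκ0.ne', one_smul]
      exact GNSS.toEuclideanCLM_Qmat_mul_gramMean)
    (T.continuous.measurable.comp (GNSS.measurable_score_zero M lam σ σt p q))
    (T.comp_memLp' hscore2)
    (by
      rw [T.integral_comp_comm (hscore2.integrable one_le_two)]
      simp only [GNSS.score_zero]
      rw [GNSS.integral_smul_designVec M (GNSS.integral_scalarNoise M lam σ p q hσt0), map_zero])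
    (q := fun t => t.ofLp ⬝ᵥ ((1 / (σ⁻¹ ^ 2 + h * σt⁻¹ ^ 2)) • GNSS.Qmat) *ᵥ t.ofLp)
    (by
      intro t
      have h1 : ∀ x, inner ℝ t (T x) = inner ℝ (T t) x := by
        intro x
        simp only [T, _root_.smul_apply, inner_smul_right, inner_smul_left]
        rw [GNSS.inner_toEuclideanCLM_Qmat]
        rfl
      simp only [h1, GNSS.score_zero]
      rw [GNSS.integral_inner_smul_sq, GNSS.integral_scalarNoise_sq M lam σ p q hσt0, ← hdef, hV,
        ← inner_toEuclideanCLM]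
      -- The sandwich collapses: the Gram form undoes one of the two factors `Q`, leaving `Q` with
      -- the scalar variance divided by `(p + q h)²`.
      have h2 : toEuclideanCLM (𝕜 := ℝ) GNSS.gramMean (T t) = (p + q * h)⁻¹ • t := by
        have h3 := congrArg (fun A : GNSS.E4 →L[ℝ] GNSS.E4 => A t)
          GNSS.toEuclideanCLM_gramMean_mul_Qmat
        simp only [ContinuousLinearMap.comp_apply, ContinuousLinearMap.id_apply] at h3
        simp only [T, _root_.smul_apply, map_smul]
        rw [h3]
      rw [h2, map_smul, inner_smul_right, ← h1]
      simp only [T, _root_.smul_apply, inner_smul_right, hκ]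
      field_simp
      rfl)
    (by
      intro x d d'
      rw [ContinuousLinearMap.comp_apply, ← map_sub, ← map_add, mul_assoc, mul_assoc]
      refine (T.le_opNorm _).trans ?_
      rw [← mul_assoc K]
      gcongr
      exact happ x d d')
    (ν := multivariateGaussian 0 ((1 / (σ⁻¹ ^ 2 + h * σt⁻¹ ^ 2)) • GNSS.Qmat))
    (by
      intro t
      rw [charFun_multivariateGaussian (GNSS.smul_Qmat_posSemidef (by positivity))]
      simp [neg_div])
    (dhat := fun n ω => what n ω - w) (fun n => (hmeas n).sub_const w)
    (hpilot.mono fun ω h => h.2)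
    (by
      filter_upwards [hpilot, ae_all_iff.2 hwhat] with ω h1 h2
      filter_upwards [h1.1] with n hdet
      obtain ⟨h3, h4⟩ := h2 n hdet
      have h5 : ∀ d, ∑ s ∈ Finset.range n, T (GNSS.score M lam σ σt p q
          (u s ω, z s ω, zt s ω, m s ω) d) = 0 ↔
          ∑ s : Fin n, GNSS.score M lam σ σt p q (u s ω, z s ω, zt s ω, m s ω) d = 0 := by
        intro d
        rw [← map_sum, ← Finset.sum_range
          (fun s => GNSS.score M lam σ σt p q (u s ω, z s ω, zt s ω, m s ω) d)]
        exact ⟨hTinj _, fun h => by rw [h, map_zero]⟩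
      have h6 := fun d => GNSS.isLikelihoodRoot_iff M (lam := lam) (σt := σt) hσ w d hdet
        (fun s : Fin n => z s ω) (fun s : Fin n => zt s ω) (fun s : Fin n => m s ω)
      refine ⟨(h5 _).2 ((h6 _).1 (by rwa [add_sub_cancel])), fun d hd => ?_⟩
      have h7 := h4 _ ((h6 d).2 ((h5 d).1 hd))
      rw [sub_sub_sub_cancel_right]
      refine h7.trans_eq ?_
      congr 1
      abel)
  refine ⟨?_, key.2⟩
  refine tendstoInMeasure_of_tendsto_ae (fun n => (hmeas n).aestronglyMeasurable) ?_
  filter_upwards [key.1] with ω hω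
  simpa using hω.add_const w
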